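/- **Definitions.** Let $(X,d)$ be a finite metric space. Its doubling dimension $\mathrm{ddim}(X)$ is the least $t\ge 0$ such that every ball can be covered by at most $2^t$ balls of half the radius. A weight function $w:X\to\mathbb R_{\ge 0}$ is *gap-2* if for all $x,y$ either $w(x)=w(y)$, or $w(x)\ge 2w(y)$, or $w(y)\ge 2w(x)$. Call $i\in\mathbb Z$ a leaf height if $2^i\le d(x,y)$ for all $x\ne y$ (if $d$ is scaled so that the minimum distance is $1$, these are the $i\le 0$). A *hierarchical net* is a decreasing sequence of sets $(N_i)_{i\in\mathbb Z}$, with $N_i=X$ at leaf heights, such that $N_{i+1}\subseteq N_i$, distinct points of $N_{i+1}$ are at distance at least $2^{i+1}$, and every point of $N_i$ is within $2^{i+1}$ of $N_{i+1}$. A *net tree* assigns to each $u\in N_i$ a parent in $N_{i+1}$, with $x\in N_i$ having parent $x\in N_{i+1}$ if $i+1$ is a leaf height; $\mathrm{Par}^{(i)}(x)$ denotes the ancestor at height $i$ of the leaf $x$ (so $\mathrm{Par}^{(i)}(x)=x$ at leaf heights). The *$\varepsilon$-smoothed distance function* induced by a net tree is $\delta(x,x)=0$ and, for $x\ne y$,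 $\delta(x,y)=d(\mathrm{Par}^{(j)}(x),\mathrm{Par}^{(j)}(y))$, where $j$ is the largest integer with $d(\mathrm{Par}^{(j)}(x),\mathrm{Par}^{(j)}(y))\ge 2^j/\varepsilon$. For a set $\mathcal F$ of functions $X\to\mathbb R_{\ge0}$, $\mathrm{ranges}(\mathcal F)=\{\{f\in\mathcal F: f(c)\le r\}: c\in X,\ r\ge 0\}$. For a random family $\mathcal F=\{f_x\}_{x\in X}$ and $H\subseteq X$ put $\mathcal F_H=\{f_x: x\in H\}$; $\mathrm{PDim}_\tau(\mathcal F)$ is the smallest integer $t\ge 0$ such that for every fixed $H\subseteq X$ with $|H|\ge 2$, $|\mathrm{ranges}(\mathcal F_H)|\le |H|^t$ with probability at least $1-\tau$. **Statement.** There is an absolute constant $C>0$ such that the following holds. Let $(X,d)$ be a finite metric space with a gap-2 weight function $w$, and let $z>0$, $0<\varepsilon\le\min\{\frac1{100z},\frac1{16}\}$ and $0<\tau<1$. There exist a hierarchical net of $X$ and a random net tree on it such that the induced random $\varepsilon$-smoothed distance function $\delta$ and the random family $\mathcal F=\{f_x=w(x)\cdot\delta(x,\cdot)^z : x\in X\}$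 satisfy: 1. for every fixed $H\subseteq X$ with $|H|\ge 2$, $$\Pr\Big[\,|\mathrm{ranges}(\mathcal F_H)|\le \Big(\frac{C}{\varepsilon}\Big)^{C\,\mathrm{ddim}(X)}\cdot\log\frac{|H|}{\tau}\cdot|H|^6\Big]\ge 1-\tau;$$ 2. almost surely, for all $x,y\in X$, $$(1-C\varepsilon z)\,\delta(x,y)^z\le d(x,y)^z\le(1+C\varepsilon z)\,\delta(x,y)^z;$$ 3. $\mathrm{PDim}_\tau(\mathcal F)\le C\big(\mathrm{ddim}(X)\log\frac1\varepsilon+\max\{0,\log\log\frac1\tau\}\big)$. -/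

import Mathlib

open scoped NNReal

noncomputable section

namespace SmoothedDoubling

/-- The doubling dimension: the least `t ≥ 0` such that every ball can be covered by at most
`2 ^ t` balls (centred in the space) of half the radius. -/
def doublingDim (X : Type*) [MetricSpace X] : ℝ :=
  sInf {t : ℝ | 0 ≤ t ∧ ∀ (x : X) (r : ℝ), 0 < r → ∃ S : Finset X, (S.card : ℝ) ≤ 2 ^ t ∧
    Metric.closedBall x r ⊆ ⋃ y ∈ S, Metric.closedBall y (r / 2)}

/-- A gap-`c` weight function: for all `x`, `y`, either `w x = w y` or one of the ratios
`w x / w y`, `w y / w x` is at least `c` (a positive number over `0` counts as `∞`). -/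
def IsGapWeight {X : Type*} (c : ℝ≥0) (w : X → ℝ≥0) : Prop :=
  ∀ x y, w x = w y ∨ c * w y ≤ w x ∨ c * w x ≤ w y

/-- `S ⊆ A` is a `ρ`-net of `A`: a `ρ`-packing and a `ρ`-covering of `A`. -/
def IsNetOf {X : Type*} [MetricSpace X] (S A : Set X) (ρ : ℝ) : Prop :=
  S ⊆ A ∧ (∀ x ∈ S, ∀ y ∈ S, x ≠ y → ρ ≤ dist x y) ∧ ∀ x ∈ A, ∃ y ∈ S, dist x y ≤ ρ

/-- Height `i` is a leaf height if `2 ^ i` is at most the minimum distance between distinct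
points. When that minimum distance is `1`, the leaf heights are exactly the `i ≤ 0`. -/
def IsLeafHeight (X : Type*) [MetricSpace X] (i : ℤ) : Prop :=
  ∀ x y : X, x ≠ y → (2 : ℝ) ^ i ≤ dist x y

/-- A hierarchical net `⋯ ⊆ N (i + 1) ⊆ N i ⊆ ⋯`: each `N (i + 1)` is a `2 ^ (i + 1)`-net of `N i`,
and `N i` is the whole space at the leaf heights. (At heights with `2 ^ i` larger than the
diameter a net is a single point, so there the hierarchy is just the root, repeated.) -/
structure HierarchicalNet (X : Type*) [MetricSpace X] where
  net : ℤ → Set X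
  isNet : ∀ i, IsNetOf (net (i + 1)) (net i) ((2 : ℝ) ^ (i + 1))
  net_leaf : ∀ i, IsLeafHeight X i → net i = Set.univ

/-- A net tree on a hierarchical net. The nodes at height `i` are the points of `N.net i`;
`parent i u` is the parent (at height `i + 1`) of the node `u` of height `i`;
`ancestor i x` is the ancestor at height `i` of the leaf `x`, determined by the parent map
through the two last fields. -/
structure NetTree {X : Type*} [MetricSpace X] (N : HierarchicalNet X) where
  parent : ℤ → X → X
  parent_mem : ∀ i, ∀ u ∈ N.net i, parent i u ∈ N.net (i + 1)
  ancestor : ℤ → X → X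
  ancestor_leaf : ∀ i, IsLeafHeight X i → ∀ x, ancestor i x = x
  ancestor_succ : ∀ i x, ancestor (i + 1) x = parent i (ancestor i x)

namespace NetTree

variable {X : Type*} [MetricSpace X] {N : HierarchicalNet X}

/-- The largest height `j` at which the ancestors of `x` and `y` are at distance at least
`2 ^ j / ε`. (For `x = y` there is no such integer, and the value is irrelevant.) -/
def sepHeight (T : NetTree N) (ε : ℝ) (x y : X) : ℤ :=
  sSup {j : ℤ | (2 : ℝ) ^ j / ε ≤ dist (T.ancestor j x) (T.ancestor j y)}

/-- The `ε`-smoothed distance function induced by the net tree. -/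
def smoothedDist (T : NetTree N) (ε : ℝ) (x y : X) : ℝ :=
  dist (T.ancestor (T.sepHeight ε x y) x) (T.ancestor (T.sepHeight ε x y) y)

/-- The indexed family `f_x = w x * δ ^ z (x, ·)`. -/
def weightedPow (T : NetTree N) (w : X → ℝ≥0) (ε z : ℝ) (x : X) : X → ℝ :=
  fun y => (w x : ℝ) * (T.smoothedDist ε x y) ^ z

end NetTree

/-- The collection of all ranges `{f ∈ F | f c ≤ r}`, with `c` in the ground set and `r ≥ 0`. -/
def ranges {α : Type*} (F : Set (α → ℝ)) : Set (Set (α → ℝ)) :=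
  {R | ∃ (c : α) (r : ℝ), 0 ≤ r ∧ R = {f | f ∈ F ∧ f c ≤ r}}

/-- The `τ`-error probabilistic shattering dimension of a random indexed function set: the
smallest `t` such that for every fixed `H` with at least two indices, `|ranges (F_H)| ≤ |H| ^ t`
with probability at least `1 - τ` (it is `⊤` if there is no such `t`). -/
def probDim {Ω V α : Type*} (P : PMF Ω) (F : Ω → V → α → ℝ) (τ : ℝ) : ℕ∞ :=
  sInf {s : ℕ∞ | ∃ t : ℕ, s = t ∧ ∀ H : Finset V, 2 ≤ H.card →
    ENNReal.ofReal (1 - τ) ≤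
      P.toOuterMeasure {ω | (ranges (F ω '' (H : Set V))).ncard ≤ H.card ^ t}}

end SmoothedDoubling

end

/-!
The random tree lives on a greedy hierarchy of nets. Four parent maps out of five send a node to a
net point covering it. Each fifth map favours a random colour: the net is coloured with `A`
colours, `A` being at most exponential in the doubling dimension, so that net points of equal
colour are far apart, and a net point of the favoured colour attracts every node in its vicinity.
Leaves drift by at most `5 * 2 ^ i` up to height `i` (`TreeData.smallDrift_tree`), which makes the
smoothed distance a `1 + O(ε)` approximation of the distance (`NetTree.SmallDrift.rpow_distortion`).
Two leaves whose distance is below the scale of a block of five heights have, whatever happened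
below, a colour that makes their paths meet (`TreeData.path_eq_of_goodColor`). So the probability
that they are still apart after `ℓ` blocks is at most `(1 - 1 / A) ^ ℓ`, and with
`ℓ ≈ A log (|H| ^ 2 / τ)` all pairs in `H` meet within `ℓ` blocks of the scale of their distance,
with probability at least `1 - τ` (`exists_random_netTree`).

On that event the ranges are counted deterministically (`NetTree.SmallDrift.ncard_ranges_le`). The
distance `δ(x, c)` depends only on the ancestors of `x` and `c` at any height where these are well
separated. For a centre `c` with nearest point `h` of `H` at distance `D`, such a height is
`j ≈ log (ε D)`, and the ancestor of `c` at height `j` is one of `(1 / ε) ^ O(ddim)` net points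
near `h`. If `2 ^ j` is within a factor `1 / ε` below or `2 ^ (5 ℓ)` above a distance in `H` from
`h`, there are few pairs `(h, j)`. Otherwise the points of `H` near `h` have all met by height `j`,
so that `δ(·, c)` is constant on them, while on the remaining points it is determined by the
ancestor of `c` at a height which depends only on their distance from `h`. Either way a range is
given by a few points of `H`, a net point, and at most two thresholds, and the number of heights in
the first case accounts for the factor `log (|H| / τ)`. The weights only change the functions
that are compared with the thresholds.

The bound on the shattering dimension follows by absorbing the remaining factors into a power of
`|H| ≥ 2`. All exponents `O(t)`, for a covering exponent `t`, are `O(ddim)` because the doubling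
dimension of a space with at least two points is at least `1` (`exists_halfCovering_le`).
-/

noncomputable section

namespace SmoothedDoubling

/-! ### Coverings and packings in doubling spaces -/

/-- Every ball is covered by at most `2 ^ t` balls of half the radius. -/
def HalfCovering (X : Type*) [MetricSpace X] (t : ℝ) : Prop :=
  ∀ (x : X) (r : ℝ), 0 < r → ∃ S : Finset X, (S.card : ℝ) ≤ 2 ^ t ∧
    Metric.closedBall x r ⊆ ⋃ y ∈ S, Metric.closedBall y (r / 2)

lemma doublingDim_nonneg (X : Type*) [MetricSpace X] : 0 ≤ doublingDim X :=
  Real.sInf_nonneg fun _ h => h.1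

section Doubling

variable {X : Type*} [MetricSpace X]

lemma exists_halfCovering [Finite X] : ∃ t : ℝ, 0 ≤ t ∧ HalfCovering X t := by
  classical
  have := Fintype.ofFinite X
  obtain ⟨n, hn⟩ : ∃ n : ℕ, Fintype.card X ≤ 2 ^ n := ⟨_, Nat.lt_two_pow_self.le⟩
  refine ⟨n, by positivity, fun x r hr => ⟨Finset.univ, ?_, fun y _ => ?_⟩⟩
  · rw [Real.rpow_natCast, Finset.card_univ]
    exact_mod_cast hn
  · simp only [Finset.mem_univ, Set.iUnion_true, Set.mem_iUnion]
    exact ⟨y, Metric.mem_closedBall_self (by positivity)⟩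

lemma exists_closest_pair [Finite X] [Nontrivial X] :
    ∃ a b : X, a ≠ b ∧ ∀ x y : X, x ≠ y → dist a b ≤ dist x y := by
  obtain ⟨p, hp, hmin⟩ := Set.exists_min_image {p : X × X | p.1 ≠ p.2} (fun p => dist p.1 p.2)
    (Set.toFinite _) (by obtain ⟨a, b, h⟩ := exists_pair_ne X; exact ⟨(a, b), h⟩)
  exact ⟨p.1, p.2, hp, fun x y h => hmin (x, y) h⟩

/-- The ball around one of two closest points whose radius is their distance contains both, while
every ball of half that radius contains a single point. -/
lemma HalfCovering.one_le [Finite X] [Nontrivial X] {t : ℝ} (h : HalfCovering X t) : 1 ≤ t := by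
  obtain ⟨a, b, hab, hmin⟩ := exists_closest_pair (X := X)
  have hd : 0 < dist a b := dist_pos.2 hab
  obtain ⟨S, hS, hcov⟩ := h a (dist a b) hd
  have key : ∀ x ∈ Metric.closedBall a (dist a b), x ∈ S := by
    intro x hx
    obtain ⟨y, hy, hxy⟩ := by simpa using hcov hx
    by_cases e : x = y
    · exact e ▸ hy
    · linarith [hmin x y e]
  have h1 := key a (by simp)
  have h2 := key b (by simp [dist_comm])
  have hc : 1 < S.card := Finset.one_lt_card.2 ⟨a, h1, b, h2, hab⟩
  have h3 : (2 : ℝ) ^ (1 : ℝ) ≤ 2 ^ t := by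
    rw [Real.rpow_one]
    exact le_trans (by exact_mod_cast hc) hS
  exact (Real.rpow_le_rpow_left_iff (by norm_num)).1 h3

/-- The infimum in the definition of the doubling dimension is positive, so it is attained up to
a factor of two, which is all that is needed below. -/
lemma exists_halfCovering_le [Finite X] [Nontrivial X] :
    1 ≤ doublingDim X ∧ ∃ t : ℝ, 1 ≤ t ∧ t ≤ 2 * doublingDim X ∧ HalfCovering X t := by
  obtain ⟨t₀, ht₀, h₀⟩ := exists_halfCovering (X := X)
  have hone : 1 ≤ doublingDim X :=
    le_csInf ⟨t₀, ht₀, h₀⟩ fun t ht => HalfCovering.one_le ht.2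
  refine ⟨hone, ?_⟩
  obtain ⟨t, ⟨_, ht⟩, hlt⟩ := exists_lt_of_csInf_lt (⟨t₀, ht₀, h₀⟩ :
    {t : ℝ | 0 ≤ t ∧ HalfCovering X t}.Nonempty)
    (show sInf {t : ℝ | 0 ≤ t ∧ HalfCovering X t} < 2 * doublingDim X from
      show doublingDim X < _ by linarith)
  exact ⟨t, HalfCovering.one_le ht, hlt.le, ht⟩

lemma HalfCovering.exists_cover {t : ℝ} (h : HalfCovering X t) (m : ℕ) (x : X) {r : ℝ}
    (hr : 0 < r) : ∃ S : Finset X, (S.card : ℝ) ≤ ((2 : ℝ) ^ t) ^ m ∧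
      Metric.closedBall x (2 ^ m * r) ⊆ ⋃ y ∈ S, Metric.closedBall y r := by
  classical
  induction m generalizing x with
  | zero => exact ⟨{x}, by simp, by simp⟩
  | succ m ih =>
    obtain ⟨S, hS, hcov⟩ := h x (2 ^ (m + 1) * r) (by positivity)
    choose F hF hFc using ih
    refine ⟨S.biUnion F, ?_, ?_⟩
    · calc ((S.biUnion F).card : ℝ) ≤ ∑ y ∈ S, ((F y).card : ℝ) := by
            exact_mod_cast Finset.card_biUnion_le
        _ ≤ ∑ y ∈ S, ((2 : ℝ) ^ t) ^ m := Finset.sum_le_sum fun y _ => hF y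
        _ = S.card * ((2 : ℝ) ^ t) ^ m := by simp
        _ ≤ 2 ^ t * ((2 : ℝ) ^ t) ^ m := by gcongr
        _ = _ := by ring
    · intro z hz
      obtain ⟨y, hy, hzy⟩ := by simpa using hcov hz
      have : z ∈ Metric.closedBall y (2 ^ m * r) := by
        rw [Metric.mem_closedBall]
        calc dist z y ≤ _ := hzy
          _ = _ := by ring
      obtain ⟨v, hv, hzv⟩ := by simpa using hFc y this
      simp only [Set.mem_iUnion, Finset.mem_biUnion]
      exact ⟨v, ⟨y, hy, hv⟩, by simpa using hzv⟩

lemma HalfCovering.card_le {t : ℝ} (h : HalfCovering X t) (m : ℕ) (x : X) {ρ : ℝ} (hρ : 0 < ρ)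
    (S : Finset X) (hsep : ∀ a ∈ S, ∀ b ∈ S, a ≠ b → ρ ≤ dist a b)
    (hS : ∀ a ∈ S, dist a x ≤ 2 ^ m * (ρ / 4)) : (S.card : ℝ) ≤ ((2 : ℝ) ^ t) ^ m := by
  classical
  obtain ⟨F, hF, hcov⟩ := h.exists_cover m x (r := ρ / 4) (by positivity)
  have : ∀ a ∈ S, ∃ y ∈ F, dist a y ≤ ρ / 4 := fun a ha => by
    simpa using hcov (hS a ha)
  choose! f hf hfd using this
  refine le_trans ?_ hF
  norm_cast
  refine Finset.card_le_card_of_injOn f hf fun a ha b hb e => ?_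
  by_contra hne
  have h1 := hsep a ha b hb hne
  have h2 := hfd a ha
  have h3 := hfd b hb
  rw [e] at h2
  linarith [dist_triangle_right a b (f b)]

/-! ### Nets and hierarchies of nets -/

lemma exists_isNetOf [Finite X] (A : Set X) {ρ : ℝ} (hρ : 0 < ρ) : ∃ S, IsNetOf S A ρ := by
  obtain ⟨S, hS, hmax⟩ := Set.exists_max_image
    {S : Set X | S ⊆ A ∧ ∀ x ∈ S, ∀ y ∈ S, x ≠ y → ρ ≤ dist x y} Set.ncard (Set.toFinite _)
    ⟨∅, by simp⟩
  refine ⟨S, hS.1, hS.2, fun x hx => ?_⟩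
  by_contra! hcon
  have hxS : x ∉ S := fun h => by
    have := hcon x h
    rw [dist_self] at this
    linarith
  have := hmax (insert x S) ⟨Set.insert_subset hx hS.1, by
    rintro a (rfl | ha) b (rfl | hb) hab
    · exact absurd rfl hab
    · exact (hcon b hb).le
    · rw [dist_comm]; exact (hcon a ha).le
    · exact hS.2 a ha b hb hab⟩
  rw [Set.ncard_insert_of_notMem hxS] at this
  omega

/-- The largest leaf height: the dyadic logarithm of the smallest distance. -/
lemma exists_isLeafHeight_iff [Finite X] [Nontrivial X] :
    ∃ i₀ : ℤ, ∀ i, IsLeafHeight X i ↔ i ≤ i₀ := by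
  obtain ⟨a, b, hab, hmin⟩ := exists_closest_pair (X := X)
  refine ⟨Int.log 2 (dist a b), fun i => ?_⟩
  rw [← Int.zpow_le_iff_le_log (by norm_num) (dist_pos.2 hab)]
  push_cast
  exact ⟨fun h => h a b hab, fun h x y hxy => h.trans (hmin x y hxy)⟩

lemma exists_hierarchicalNet [Finite X] {i₀ : ℤ} (hi₀ : ∀ i, IsLeafHeight X i ↔ i ≤ i₀) :
    Nonempty (HierarchicalNet X) := by
  choose net hnet using fun (A : Set X) (i : ℤ) =>
    exists_isNetOf A (ρ := (2 : ℝ) ^ i) (by positivity)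
  let f : ℕ → Set X := fun k => Nat.rec Set.univ (fun k A => net A (i₀ + (k + 1 : ℕ))) k
  refine ⟨⟨fun i => f (i - i₀).toNat, fun i => ?_, fun i hi => ?_⟩⟩
  · by_cases h : i < i₀
    · have h1 : (i + 1 - i₀).toNat = 0 := by omega
      have h2 : (i - i₀).toNat = 0 := by omega
      simp only [h1, h2]
      exact ⟨subset_rfl, fun x _ y _ hxy => (hi₀ (i + 1)).2 (by omega) x y hxy,
        fun x hx => ⟨x, hx, by rw [dist_self]; positivity⟩⟩
    · have h1 : (i + 1 - i₀).toNat = (i - i₀).toNat + 1 := by omega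
      have h2 : i₀ + (((i - i₀).toNat + 1 : ℕ) : ℤ) = i + 1 := by omega
      have := hnet (f (i - i₀).toNat) (i₀ + ((i - i₀).toNat + 1 : ℕ))
      rw [h2] at this
      simp only [h1]
      change IsNetOf (net (f (i - i₀).toNat) (i₀ + ((i - i₀).toNat + 1 : ℕ))) _ _
      rwa [h2]
  · have h : (i - i₀).toNat = 0 := by have := (hi₀ i).1 hi; omega
    simp only [h]
    rfl

lemma HierarchicalNet.le_dist (N : HierarchicalNet X) {i : ℤ} {x y : X} (hx : x ∈ N.net i)
    (hy : y ∈ N.net i) (hxy : x ≠ y) : (2 : ℝ) ^ i ≤ dist x y := by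
  have h := N.isNet (i - 1)
  rw [sub_add_cancel] at h
  exact h.2.1 x hx y hy hxy

/-- Points of a finite set can be coloured with `A` colours so that points at distance at most
`ρ` get different colours, if no point has more than `A` points (itself included) within `ρ`. -/
lemma exists_coloring [Finite X] (S : Set X) {ρ : ℝ} (hρ : 0 ≤ ρ) {A : ℕ} (hA : 0 < A)
    (h : ∀ x ∈ S, ∀ F : Finset X, ↑F ⊆ S → (∀ y ∈ F, dist y x ≤ ρ) → F.card ≤ A) :
    ∃ col : X → Fin A, ∀ x ∈ S, ∀ y ∈ S, dist x y ≤ ρ → col x = col y → x = y := by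
  classical
  induction S, Set.toFinite S using Set.Finite.induction_on with
  | empty => exact ⟨fun _ => ⟨0, hA⟩, by simp⟩
  | @insert a S ha hfin ih =>
    obtain ⟨col, hcol⟩ := ih fun x hx F hF =>
      h x (Set.mem_insert_of_mem _ hx) F (hF.trans (Set.subset_insert _ _))
    let B : Finset X := hfin.toFinset.filter fun y => dist y a ≤ ρ
    have haB : a ∉ B := by simp [B, ha]
    have hB : (insert a B).card ≤ A := by
      refine h a (Set.mem_insert _ _) _ (fun y hy => ?_) (fun y hy => ?_)
      · rcases Finset.mem_insert.1 (Finset.mem_coe.1 hy) with rfl | hy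
        · exact Set.mem_insert _ _
        · exact Set.mem_insert_of_mem _ (by simpa using (Finset.mem_filter.1 hy).1)
      · rcases Finset.mem_insert.1 hy with rfl | hy
        · rwa [dist_self]
        · exact (Finset.mem_filter.1 hy).2
    rw [Finset.card_insert_of_notMem haB] at hB
    obtain ⟨q, hq⟩ : ∃ q, q ∉ B.image col := by
      by_contra! hall
      have h1 : (B.image col).card = A := by
        rw [Finset.eq_univ_of_forall hall, Finset.card_univ, Fintype.card_fin]
      have h2 := Finset.card_image_le (s := B) (f := col)
      omega
    have hqB : ∀ y ∈ S, dist y a ≤ ρ → col y ≠ q := fun y hy hd e =>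
      hq (Finset.mem_image.2 ⟨y, by simp [B, hy, hd], e⟩)
    have hne : ∀ y ∈ S, y ≠ a := fun y hy e => ha (e ▸ hy)
    refine ⟨Function.update col a q, ?_⟩
    rintro x (rfl | hx) y (rfl | hy) hd e
    · rfl
    · rw [Function.update_self, Function.update_of_ne (hne y hy)] at e
      exact absurd e.symm (hqB y hy (by rwa [dist_comm]))
    · rw [Function.update_self, Function.update_of_ne (hne x hx)] at e
      exact absurd e (hqB x hx hd)
    · rw [Function.update_of_ne (hne x hx), Function.update_of_ne (hne y hy)] at e
      exact hcol x hx y hy hd e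

end Doubling

/-! ### The smoothed distance of a net tree with small drift -/

namespace NetTree

variable {X : Type*} [MetricSpace X] {N : HierarchicalNet X}

/-- The tree has small drift if the ancestor of a leaf at height `i` is within `5 * 2 ^ i` of it. -/
def SmallDrift (T : NetTree N) : Prop := ∀ i x, dist x (T.ancestor i x) ≤ 5 * (2 : ℝ) ^ i

/-- The heights at which the ancestors of `x` and `y` are well separated; `sepHeight` is the
largest of them. -/
def sepSet (T : NetTree N) (ε : ℝ) (x y : X) : Set ℤ :=
  {j : ℤ | (2 : ℝ) ^ j / ε ≤ dist (T.ancestor j x) (T.ancestor j y)}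

variable (T : NetTree N) {ε : ℝ}

lemma ancestor_eq_of_le {i j : ℤ} {x y : X} (h : T.ancestor i x = T.ancestor i y) (hij : i ≤ j) :
    T.ancestor j x = T.ancestor j y := by
  induction j, hij using Int.leInduction with
  | base => exact h
  | succ k _ ih => rw [T.ancestor_succ, T.ancestor_succ, ih]

lemma ancestor_mem (x : X) (i : ℤ) {i₀ : ℤ} (hi₀ : IsLeafHeight X i₀) :
    T.ancestor i x ∈ N.net i := by
  by_cases h : i₀ ≤ i
  · induction i, h using Int.leInduction with
    | base => rw [N.net_leaf _ hi₀]; trivial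
    | succ k _ ih => rw [T.ancestor_succ]; exact T.parent_mem _ _ ih
  · rw [N.net_leaf i fun x y hxy => le_trans (zpow_le_zpow_right₀ (by norm_num) (by omega))
      (hi₀ x y hxy)]
    trivial

lemma smoothedDist_self (x : X) : T.smoothedDist ε x x = 0 := dist_self _

/-- The constant `10` is twice the drift constant; it recurs in the estimates below. -/
lemma SmallDrift.dist_le {T : NetTree N} (hT : T.SmallDrift) (j : ℤ) (x y : X) :
    dist x y ≤ dist (T.ancestor j x) (T.ancestor j y) + 10 * 2 ^ j := by
  have h1 := hT j x
  have h2 := hT j y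
  have h3 := dist_triangle4_right x y (T.ancestor j x) (T.ancestor j y)
  linarith

lemma SmallDrift.le_dist {T : NetTree N} (hT : T.SmallDrift) (j : ℤ) (x y : X) :
    dist (T.ancestor j x) (T.ancestor j y) ≤ dist x y + 10 * 2 ^ j := by
  have h1 := hT j x
  have h2 := hT j y
  have h3 := dist_triangle4 (T.ancestor j x) x y (T.ancestor j y)
  rw [dist_comm (T.ancestor j x) x] at h3
  linarith

lemma SmallDrift.mem_sepSet {T : NetTree N} (hT : T.SmallDrift) {e : ℕ}
    (he : 1 / ε + 10 ≤ 2 ^ e) {x y : X} {j : ℤ} (h : (2 : ℝ) ^ (j + e) ≤ dist x y) :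
    j ∈ T.sepSet ε x y := by
  have h1 := hT.dist_le j x y
  rw [zpow_add₀ (by norm_num), zpow_natCast] at h
  have h2 : (2 : ℝ) ^ j * (1 / ε + 10) ≤ 2 ^ j * 2 ^ e := by gcongr
  change (2 : ℝ) ^ j / ε ≤ _
  have h3 : (2 : ℝ) ^ j / ε = 2 ^ j * (1 / ε + 10) - 10 * 2 ^ j := by ring
  linarith

lemma SmallDrift.le_of_mem_sepSet {T : NetTree N} (hT : T.SmallDrift) (hε : 0 < ε)
    (hε' : ε ≤ 1 / 16) {x y : X} {j : ℤ} (h : j ∈ T.sepSet ε x y) :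
    (2 : ℝ) ^ j ≤ dist x y := by
  have h1 := hT.le_dist j x y
  have h2 : (2 : ℝ) ^ j / ε ≤ dist (T.ancestor j x) (T.ancestor j y) := h
  have h3 : (2 : ℝ) ^ j * 16 ≤ 2 ^ j / ε := by
    rw [le_div_iff₀ hε]
    have : (0 : ℝ) < 2 ^ j := by positivity
    nlinarith
  have : (0 : ℝ) < 2 ^ j := by positivity
  linarith

lemma SmallDrift.isGreatest_sepHeight {T : NetTree N} (hT : T.SmallDrift) (hε : 0 < ε)
    (hε' : ε ≤ 1 / 16) {x y : X} {j : ℤ} (h : j ∈ T.sepSet ε x y) :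
    IsGreatest (T.sepSet ε x y) (T.sepHeight ε x y) := by
  have hb : BddAbove (T.sepSet ε x y) := ⟨Int.log 2 (dist x y), fun i hi => by
    have h1 := hT.le_of_mem_sepSet hε hε' hi
    have h2 : (0 : ℝ) < 2 ^ i := by positivity
    rw [← Int.zpow_le_iff_le_log (by norm_num) (h2.trans_le h1)]
    exact_mod_cast h1⟩
  exact ⟨Int.csSup_mem ⟨j, h⟩ hb, fun i hi => le_csSup hb hi⟩

/-- Below a height at which two leaves are well separated, their smoothed distance sees nothing
but their ancestors at that height. -/
lemma SmallDrift.smoothedDist_congr {T : NetTree N} (hT : T.SmallDrift) (hε : 0 < ε)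
    (hε' : ε ≤ 1 / 16) {x x' y y' : X} {j : ℤ} (h : j ∈ T.sepSet ε x y)
    (hx : T.ancestor j x = T.ancestor j x') (hy : T.ancestor j y = T.ancestor j y') :
    T.smoothedDist ε x y = T.smoothedDist ε x' y' := by
  have hiff : ∀ i, j ≤ i → (i ∈ T.sepSet ε x y ↔ i ∈ T.sepSet ε x' y') := fun i hi => by
    simp only [sepSet, Set.mem_ofPred_eq, T.ancestor_eq_of_le hx hi, T.ancestor_eq_of_le hy hi]
  have h1 := hT.isGreatest_sepHeight hε hε' h
  have h2 := hT.isGreatest_sepHeight hε hε' ((hiff j le_rfl).1 h)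
  have hj : j ≤ T.sepHeight ε x y := h1.2 h
  have hj' : j ≤ T.sepHeight ε x' y' := h2.2 ((hiff j le_rfl).1 h)
  have e : T.sepHeight ε x y = T.sepHeight ε x' y' :=
    le_antisymm (h2.2 ((hiff _ hj).1 h1.1)) (h1.2 ((hiff _ hj').2 h2.1))
  unfold smoothedDist
  rw [← e, T.ancestor_eq_of_le hx hj, T.ancestor_eq_of_le hy hj]

lemma SmallDrift.exists_mem_sepSet {T : NetTree N} (hT : T.SmallDrift) {x y : X} (hxy : x ≠ y) :
    ∃ j, j ∈ T.sepSet ε x y := by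
  obtain ⟨e, he⟩ : ∃ e : ℕ, 1 / ε + 10 ≤ 2 ^ e :=
    (pow_unbounded_of_one_lt _ (by norm_num : (1 : ℝ) < 2)).imp fun _ => le_of_lt
  refine ⟨Int.log 2 (dist x y) - e, hT.mem_sepSet he ?_⟩
  rw [sub_add_cancel]
  exact_mod_cast Int.zpow_log_le_self (b := 2) (by norm_num) (dist_pos.2 hxy)

lemma SmallDrift.smoothedDist_pos_and_dist_bounds {T : NetTree N} (hT : T.SmallDrift) (hε : 0 < ε)
    (hε' : ε ≤ 1 / 16) {x y : X} (hxy : x ≠ y) :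
    0 < T.smoothedDist ε x y ∧
      (1 - 10 * ε) * T.smoothedDist ε x y ≤ dist x y ∧
      dist x y ≤ (1 + 10 * ε) * T.smoothedDist ε x y := by
  obtain ⟨j, hj⟩ := hT.exists_mem_sepSet (ε := ε) hxy
  have h1 : (2 : ℝ) ^ (T.sepHeight ε x y) / ε ≤ T.smoothedDist ε x y :=
    (hT.isGreatest_sepHeight hε hε' hj).1
  have h2 := hT.dist_le (T.sepHeight ε x y) x y
  have h3 := hT.le_dist (T.sepHeight ε x y) x y
  have h4 : (0 : ℝ) < 2 ^ (T.sepHeight ε x y) / ε := by positivity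
  have h5 : (2 : ℝ) ^ (T.sepHeight ε x y) ≤ ε * T.smoothedDist ε x y := by
    rw [div_le_iff₀ hε] at h1
    linarith
  change dist x y ≤ T.smoothedDist ε x y + _ at h2
  change T.smoothedDist ε x y ≤ _ at h3
  exact ⟨h4.trans_le h1, by linarith, by linarith⟩

/-- The relative error `10 ε` of the smoothed distance becomes `O(ε z)` on raising to the power
`z`, because `ε z` is bounded. -/
lemma SmallDrift.rpow_distortion {T : NetTree N} (hT : T.SmallDrift) {C z : ℝ} (hC : 30 ≤ C)
    (hz : 0 < z) (hε : 0 < ε) (hεz : ε ≤ 1 / (100 * z)) (hε' : ε ≤ 1 / 16) (x y : X) :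
    (1 - C * (ε * z)) * (T.smoothedDist ε x y) ^ z ≤ (dist x y) ^ z ∧
      (dist x y) ^ z ≤ (1 + C * (ε * z)) * (T.smoothedDist ε x y) ^ z := by
  by_cases hxy : x = y
  · subst hxy
    rw [smoothedDist_self, dist_self, Real.zero_rpow hz.ne']
    simp
  obtain ⟨h0, h1, h2⟩ := hT.smoothedDist_pos_and_dist_bounds hε hε' hxy
  have hez : 0 < ε * z := by positivity
  have hez' : ε * z ≤ 1 / 100 := by
    rw [le_div_iff₀ (by positivity)] at hεz
    linarith
  have hδ : 0 < T.smoothedDist ε x y ^ z := Real.rpow_pos_of_pos h0 z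
  constructor
  · have hpos : 0 < 1 - 10 * ε := by linarith
    refine le_trans ?_ (Real.rpow_le_rpow (by positivity) h1 hz.le)
    rw [Real.mul_rpow hpos.le h0.le]
    refine mul_le_mul_of_nonneg_right ?_ hδ.le
    have hinv : (1 - 10 * ε)⁻¹ ≤ 1 + 30 * ε := by
      rw [inv_le_iff_one_le_mul₀ hpos]
      nlinarith
    have hlog : -(30 * ε) ≤ Real.log (1 - 10 * ε) := by
      linarith [Real.one_sub_inv_le_log_of_pos hpos]
    rw [Real.rpow_def_of_pos hpos]
    have := Real.add_one_le_exp (Real.log (1 - 10 * ε) * z)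
    nlinarith
  · refine le_trans (Real.rpow_le_rpow dist_nonneg h2 hz.le) ?_
    rw [Real.mul_rpow (by positivity) h0.le]
    refine mul_le_mul_of_nonneg_right ?_ hδ.le
    have hle : (1 + 10 * ε) ^ z ≤ Real.exp (10 * (ε * z)) := by
      rw [show 10 * (ε * z) = 10 * ε * z by ring, Real.exp_mul]
      refine Real.rpow_le_rpow (by positivity) ?_ hz.le
      linarith [Real.add_one_le_exp (10 * ε)]
    refine hle.trans ?_
    have h3 := Real.abs_exp_sub_one_le (x := 10 * (ε * z)) (by
      rw [abs_of_pos (by positivity)]; linarith)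
    rw [abs_of_pos (by positivity : 0 < 10 * (ε * z))] at h3
    have h4 := le_abs_self (Real.exp (10 * (ε * z)) - 1)
    nlinarith

end NetTree

/-! ### Counting ranges -/

section Thresholds

variable {X : Type*} [DecidableEq X]

/-- The sublevel sets of `g` on `S`, indexed by the elements of `S`, and the empty set. -/
def thresholds (g : X → ℝ) (S : Finset X) : Finset (Finset X) :=
  insert ∅ (S.image fun a => S.filter (g · ≤ g a))

lemma card_thresholds_le (g : X → ℝ) (S : Finset X) : (thresholds g S).card ≤ S.card + 1 :=
  (Finset.card_insert_le _ _).trans (Nat.succ_le_succ Finset.card_image_le)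

lemma filter_mem_thresholds (g : X → ℝ) (S : Finset X) (r : ℝ) :
    S.filter (g · ≤ r) ∈ thresholds g S := by
  rcases (S.filter (g · ≤ r)).eq_empty_or_nonempty with h | h
  · rw [h]
    exact Finset.mem_insert_self _ _
  · obtain ⟨a, ha, hmax⟩ := Finset.exists_max_image _ g h
    refine Finset.mem_insert_of_mem (Finset.mem_image.2 ⟨a, (Finset.mem_filter.1 ha).1, ?_⟩)
    ext b
    simp only [Finset.mem_filter]
    exact ⟨fun hb => ⟨hb.1, hb.2.trans (Finset.mem_filter.1 ha).2⟩,
      fun hb => ⟨hb.1, hmax b (Finset.mem_filter.2 hb)⟩⟩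

end Thresholds

/-- The ranges of an indexed family are images of sublevel sets of indices. -/
lemma ncard_ranges_image_le {V α : Type*} (F : V → α → ℝ) (H : Finset V)
    (U : Finset (Finset V)) (hU : ∀ c r, 0 ≤ r → H.filter (fun x => F x c ≤ r) ∈ U) :
    (ranges (F '' (H : Set V))).ncard ≤ U.card := by
  classical
  have hsub : ranges (F '' (H : Set V)) ⊆
      ↑(U.image fun E : Finset V => F '' (E : Set V)) := by
    rintro R ⟨c, r, hr, rfl⟩
    refine Finset.mem_coe.2 (Finset.mem_image.2 ⟨_, hU c r hr, ?_⟩)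
    ext f
    simp only [Finset.coe_filter, Set.mem_image, Set.mem_ofPred_eq, Finset.mem_coe]
    constructor
    · rintro ⟨x, ⟨hx, hr⟩, rfl⟩
      exact ⟨⟨x, hx, rfl⟩, hr⟩
    · rintro ⟨⟨x, hx, rfl⟩, hr⟩
      exact ⟨x, ⟨hx, hr⟩, rfl⟩
  refine (Set.ncard_le_ncard hsub (Finset.finite_toSet _)).trans ?_
  rw [Set.ncard_coe_finset]
  exact Finset.card_image_le

namespace NetTree

variable {X : Type*} [MetricSpace X] {N : HierarchicalNet X}

/-- On `H`, the paths of any two points meet at most `L` heights above the scale of their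
distance. -/
def MergesWithin (T : NetTree N) (H : Finset X) (L : ℕ) : Prop :=
  ∀ x ∈ H, ∀ y ∈ H, x ≠ y → ∀ j : ℤ, Int.log 2 (dist x y) + L ≤ j →
    T.ancestor j x = T.ancestor j y

end NetTree

namespace NetTree

variable {X : Type*} [MetricSpace X] {N : HierarchicalNet X}

/-- The functions `x ↦ w x * δ(x, c) ^ z`, `c` being a leaf below the node `v` of height `j`; any
leaf of that kind serves as a representative when only the tree above height `j` matters. -/
def nodeFun [Nonempty X] (T : NetTree N) (w : X → ℝ≥0) (ε z : ℝ) (j : ℤ) (v x : X) : ℝ :=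
  T.weightedPow w ε z x (Function.invFun (T.ancestor j) v)

lemma SmallDrift.weightedPow_eq_nodeFun [Nonempty X] {T : NetTree N} (hT : T.SmallDrift)
    {ε z : ℝ} (hε : 0 < ε) (hε' : ε ≤ 1 / 16) (w : X → ℝ≥0) {x c : X} {j : ℤ}
    (h : j ∈ T.sepSet ε x c) :
    T.weightedPow w ε z x c = T.nodeFun w ε z j (T.ancestor j c) x := by
  unfold nodeFun weightedPow
  rw [hT.smoothedDist_congr hε hε' h rfl
    (Function.invFun_eq (f := T.ancestor j) ⟨c, rfl⟩).symm]

lemma card_image_union_le {X : Type*} [DecidableEq X] (A B : Finset (Finset X)) :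
    ((A ×ˢ B).image fun p => p.1 ∪ p.2).card ≤ A.card * B.card :=
  Finset.card_image_le.trans (Finset.card_product _ _).le

open Classical in
/-- If all merges on `H` happen soon, then `H` has few ranges. A centre `c` outside `H` whose
nearest point in `H` is `h`, at distance `D`, is of one of two kinds. If some distance from `h`
within `H` is close to `ε D`, up to the allowed delay `2 ^ L` and a factor `1 / ε`, then the height
`j ≈ log (ε D)` is one of few, and the ancestor of `c` at height `j` determines `δ(·, c)` on `H`.
Otherwise `H` splits into a part near `h`, merged already at height `j`, on which `δ(·, c)` is
constant, and a part far from `h`, on which `δ(·, c)` is determined by the ancestor of `c` at a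
height given by the distance of the far part; on the near part a range is a sublevel set of `w`. -/
theorem SmallDrift.ncard_ranges_le [Finite X] [Nonempty X] {T : NetTree N} (hT : T.SmallDrift)
    {i₀ : ℤ} (hi₀ : IsLeafHeight X i₀) {ε z : ℝ} (hε : 0 < ε) (hε' : ε ≤ 1 / 16) {e L V : ℕ}
    (he : 1 / ε + 10 ≤ 2 ^ e)
    (hV : ∀ (h : X) (j : ℤ) (F : Finset X), (∀ v ∈ F, v ∈ N.net j) →
      (∀ v ∈ F, dist v h ≤ (2 : ℝ) ^ (j + e + 2)) → F.card ≤ V)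
    (w : X → ℝ≥0) (H : Finset X) (hne : H.Nonempty) (hmerge : T.MergesWithin H L) :
    (ranges (T.weightedPow w ε z '' (H : Set X))).ncard ≤
      H.card * (H.card + 1) + (H.card + 1) +
        H.card * (H.card * (V * ((H.card + 1) * (H.card + 1)))) +
        H.card * (H.card * ((L + e + 2) * (V * (H.card + 1)))) := by
  have := Fintype.ofFinite X
  -- The candidates for an ancestor at height `j` of a centre near `h`.
  let B : X → ℤ → Finset X := fun h j =>
    Finset.univ.filter fun v => v ∈ N.net j ∧ dist v h ≤ (2 : ℝ) ^ (j + e + 2)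
  have hB : ∀ h j, (B h j).card ≤ V := fun h j =>
    hV h j _ (fun v hv => (Finset.mem_filter.1 hv).2.1) (fun v hv => (Finset.mem_filter.1 hv).2.2)
  let Q : X → X → Finset X := fun h f => H.filter fun x => dist h x < dist h f
  let k : X → X → ℤ := fun h f => Int.log 2 (dist h f) - e - 1
  let J : X → X → Finset ℤ := fun h f =>
    Finset.Icc (Int.log 2 (dist h f) - (e + 1)) (Int.log 2 (dist h f) + L)
  let U₁ := H.biUnion fun c => thresholds (fun x => T.weightedPow w ε z x c) H
  let U₂ := thresholds (fun x => (w x : ℝ)) H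
  let U₃ := H.biUnion fun h => H.biUnion fun f => (B h (k h f)).biUnion fun v =>
    (thresholds (fun x => (w x : ℝ)) (Q h f) ×ˢ
      thresholds (T.nodeFun w ε z (k h f) v) (H \ Q h f)).image fun p => p.1 ∪ p.2
  let U₄ := H.biUnion fun h => H.biUnion fun f => (J h f).biUnion fun j =>
    (B h j).biUnion fun v => thresholds (T.nodeFun w ε z j v) H
  have hcard : (U₁ ∪ U₂ ∪ U₃ ∪ U₄).card ≤ H.card * (H.card + 1) + (H.card + 1) +
        H.card * (H.card * (V * ((H.card + 1) * (H.card + 1)))) +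
        H.card * (H.card * ((L + e + 2) * (V * (H.card + 1)))) := by
    refine (Finset.card_union_le _ _).trans (Nat.add_le_add
      ((Finset.card_union_le _ _).trans (Nat.add_le_add
        ((Finset.card_union_le _ _).trans (Nat.add_le_add ?_ ?_)) ?_)) ?_)
    · exact Finset.card_biUnion_le_card_mul _ _ _ fun c _ => card_thresholds_le _ _
    · exact card_thresholds_le _ _
    · refine Finset.card_biUnion_le_card_mul _ _ _ fun h _ =>
        Finset.card_biUnion_le_card_mul _ _ _ fun f _ =>
          (Finset.card_biUnion_le_card_mul _ _ _ fun v _ => ?_).trans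
            (Nat.mul_le_mul_right _ (hB _ _))
      refine (card_image_union_le _ _).trans (Nat.mul_le_mul ?_ ?_)
      · exact (card_thresholds_le _ _).trans
          (Nat.succ_le_succ (Finset.card_le_card (Finset.filter_subset _ _)))
      · exact (card_thresholds_le _ _).trans
          (Nat.succ_le_succ (Finset.card_le_card Finset.sdiff_subset))
    · refine Finset.card_biUnion_le_card_mul _ _ _ fun h _ =>
        Finset.card_biUnion_le_card_mul _ _ _ fun f _ =>
          (Finset.card_biUnion_le_card_mul _ _ _ fun j _ =>
            (Finset.card_biUnion_le_card_mul _ _ _ fun v _ => card_thresholds_le _ _).trans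
              (Nat.mul_le_mul_right _ (hB _ _))).trans (Nat.mul_le_mul_right _ ?_)
      rw [Int.card_Icc]
      omega
  refine (ncard_ranges_image_le _ H (U₁ ∪ U₂ ∪ U₃ ∪ U₄) fun c r hr => ?_).trans hcard
  simp only [Finset.mem_union]
  by_cases hcH : c ∈ H
  · exact Or.inl (Or.inl (Or.inl (Finset.mem_biUnion.2 ⟨c, hcH, filter_mem_thresholds _ _ r⟩)))
  obtain ⟨h, hh, hmin⟩ := Finset.exists_min_image H (fun x => dist x c) hne
  have hD : 0 < dist h c := dist_pos.2 fun E => hcH (E ▸ hh)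
  -- The height `j` is about `log (ε D)`; all of `H` is well separated from `c` there.
  obtain ⟨j, hj⟩ : ∃ j : ℤ, Int.log 2 (dist h c) = j + e :=
    ⟨Int.log 2 (dist h c) - e, by ring⟩
  have hjD : (2 : ℝ) ^ (j + e) ≤ dist h c := by
    rw [← hj]
    exact_mod_cast Int.zpow_log_le_self (b := 2) (by norm_num) hD
  have hDj : dist h c < (2 : ℝ) ^ (j + e + 1) := by
    rw [← hj]
    exact_mod_cast Int.lt_zpow_succ_log_self (b := 2) (by norm_num) (dist h c)
  have hsep : ∀ x ∈ H, j ∈ T.sepSet ε x c := fun x hx =>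
    hT.mem_sepSet he (hjD.trans (hmin x hx))
  have he10 : (10 : ℝ) ≤ 2 ^ e := le_trans (by linarith [one_div_pos.2 hε]) he
  have hpow : ∀ i : ℤ, (2 : ℝ) ^ (i + e) = 2 ^ i * 2 ^ e := fun i => by
    rw [zpow_add₀ (by norm_num), zpow_natCast]
  have hnode : ∀ i : ℤ, dist h c ≤ (2 : ℝ) ^ (i + e + 1) → T.ancestor i c ∈ B h i := by
    intro i hi
    refine Finset.mem_filter.2 ⟨Finset.mem_univ _, T.ancestor_mem c i hi₀, ?_⟩
    have h1 := hT i c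
    have h2 : dist (T.ancestor i c) h ≤ dist c (T.ancestor i c) + dist h c := by
      rw [dist_comm c, dist_comm h c]
      exact dist_triangle _ _ _
    have h3 : (2 : ℝ) ^ i * 10 ≤ 2 ^ i * 2 ^ e := by gcongr
    rw [zpow_add₀ (by norm_num) _ 1, hpow] at hi
    rw [zpow_add₀ (by norm_num) _ 2, hpow]
    norm_num at hi ⊢
    have h4 : (0 : ℝ) < 2 ^ i := by positivity
    linarith
  by_cases hbad : ∃ f ∈ H, j ∈ J h f
  · obtain ⟨f, hf, hjf⟩ := hbad
    refine Or.inr ?_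
    simp only [U₄, Finset.mem_biUnion]
    refine ⟨h, hh, f, hf, j, hjf, T.ancestor j c, hnode j hDj.le, ?_⟩
    rw [Finset.filter_congr fun x hx => by
      rw [hT.weightedPow_eq_nodeFun hε hε' w (hsep x hx)]]
    exact filter_mem_thresholds _ _ r
  · have hgap : ∀ x ∈ H, x = h ∨ (x ≠ h ∧ Int.log 2 (dist h x) + L < j) ∨
        (x ≠ h ∧ j + e + 1 < Int.log 2 (dist h x)) := by
      intro x hx
      by_cases hxh : x = h
      · exact Or.inl hxh
      have : j ∉ J h x := fun hjx => hbad ⟨x, hx, hjx⟩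
      simp only [J, Finset.mem_Icc] at this
      rcases lt_or_ge (Int.log 2 (dist h x) + L) j with h1 | h1
      · exact Or.inr (Or.inl ⟨hxh, h1⟩)
      · exact Or.inr (Or.inr ⟨hxh, by omega⟩)
    -- On the near part the smoothed distance to `c` is constant.
    have hδ : 0 < T.smoothedDist ε h c ^ z :=
      Real.rpow_pos_of_pos (hT.smoothedDist_pos_and_dist_bounds hε hε' (dist_pos.1 hD)).1 z
    have hnear : ∀ x ∈ H, (x = h ∨ (x ≠ h ∧ Int.log 2 (dist h x) + L < j)) →
        (T.weightedPow w ε z x c ≤ r ↔ (w x : ℝ) ≤ r / T.smoothedDist ε h c ^ z) := by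
      intro x hx hxh
      have hanc : T.ancestor j x = T.ancestor j h := by
        rcases hxh with rfl | ⟨hne', hlt⟩
        · rfl
        · exact (hmerge h hh x hx (Ne.symm hne') j hlt.le).symm
      rw [le_div_iff₀ hδ]
      unfold weightedPow
      rw [hT.smoothedDist_congr hε hε' (hsep x hx) hanc rfl]
    by_cases hfar : ∃ f ∈ H, f ≠ h ∧ j + e + 1 < Int.log 2 (dist h f)
    · obtain ⟨f, hf, hfmin⟩ := Finset.exists_min_image
        (H.filter fun f => f ≠ h ∧ j + e + 1 < Int.log 2 (dist h f)) (fun f => dist h f)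
        (by obtain ⟨f, hf, hf'⟩ := hfar; exact ⟨f, Finset.mem_filter.2 ⟨hf, hf'⟩⟩)
      obtain ⟨hfH, hfh, hfj⟩ := Finset.mem_filter.1 hf
      have hfpos : 0 < dist h f := dist_pos.2 (Ne.symm hfh)
      obtain ⟨i, hi⟩ : ∃ i : ℤ, i = k h f := ⟨_, rfl⟩
      have hlog : Int.log 2 (dist h f) = i + e + 1 := by simp only [hi, k]; ring
      have hif : (2 : ℝ) ^ (i + e + 1) ≤ dist h f := by
        rw [← hlog]
        exact_mod_cast Int.zpow_log_le_self (b := 2) (by norm_num) hfpos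
      have hDi : dist h c ≤ (2 : ℝ) ^ (i + e) :=
        hDj.le.trans (zpow_le_zpow_right₀ (by norm_num) (by omega))
      have hi1 : (2 : ℝ) ^ (i + e + 1) = 2 * 2 ^ (i + e) := by
        rw [zpow_add₀ (by norm_num) _ 1, zpow_one]; ring
      have hQ : ∀ x ∈ H, x ∈ Q h f ↔ (x = h ∨ (x ≠ h ∧ Int.log 2 (dist h x) + L < j)) := by
        intro x hx
        simp only [Q, Finset.mem_filter, hx, true_and]
        constructor
        · intro hlt
          rcases hgap x hx with h1 | h1 | h1
          · exact Or.inl h1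
          · exact Or.inr h1
          · exact absurd (hfmin x (Finset.mem_filter.2 ⟨hx, h1⟩)) (not_le.2 hlt)
        · rintro (rfl | ⟨hxh, hlt⟩)
          · rwa [dist_self]
          · by_contra! hle
            have := Int.log_mono_right (b := 2) hfpos hle
            omega
      refine Or.inl (Or.inr ?_)
      simp only [U₃, Finset.mem_biUnion, Finset.mem_image]
      refine ⟨h, hh, f, hfH, T.ancestor i c, hi ▸ hnode i ?_, ?_⟩
      · rw [hi1]
        have : (0 : ℝ) < 2 ^ (i + e) := by positivity
        linarith
      refine ⟨((Q h f).filter fun x => (w x : ℝ) ≤ r / T.smoothedDist ε h c ^ z,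
        (H \ Q h f).filter fun x => T.nodeFun w ε z (k h f) (T.ancestor i c) x ≤ r),
        Finset.mem_product.2 ⟨filter_mem_thresholds _ _ _, filter_mem_thresholds _ _ r⟩, ?_⟩
      ext x
      simp only [Finset.mem_union, Finset.mem_filter, Finset.mem_sdiff]
      have hQH : x ∈ Q h f → x ∈ H := fun hx => (Finset.mem_filter.1 hx).1
      by_cases hx : x ∈ H
      · by_cases hxQ : x ∈ Q h f
        · simp [hx, hxQ, hnear x hx ((hQ x hx).1 hxQ)]
        · have hge : dist h f ≤ dist h x := by
            by_contra! hlt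
            exact hxQ (Finset.mem_filter.2 ⟨hx, hlt⟩)
          have htri := dist_triangle_right h x c
          have hxi : i ∈ T.sepSet ε x c := hT.mem_sepSet he (by linarith)
          simp [hx, hxQ, hT.weightedPow_eq_nodeFun hε hε' w hxi, hi]
      · simp [hx, mt hQH hx]
    · refine Or.inl (Or.inl (Or.inr ?_))
      push Not at hfar
      rw [Finset.filter_congr fun x hx => hnear x hx (by
        rcases hgap x hx with h1 | h1 | h1
        · exact Or.inl h1
        · exact Or.inr h1
        · exact absurd h1.2 (not_lt.2 (hfar x hx h1.1)))]
      exact filter_mem_thresholds _ _ _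

end NetTree

/-! ### A counting bound for adaptive avoidance -/

/-- A word whose letters at the places in `S` all avoid a letter determined by the earlier ones:
there are as many such words as if the forbidden letters were fixed, because exchanging the
forbidden letter with a fixed one, place by place, is an injective map on words. -/
lemma card_avoid_le {κ : Type*} [Fintype κ] [DecidableEq κ] [Nonempty κ] {M : ℕ}
    (q : Fin M → (Fin M → κ) → κ)
    (hq : ∀ b ω ω', (∀ b' < b, ω b' = ω' b') → q b ω = q b ω') (S : Finset (Fin M)) :
    ((Finset.univ.filter fun ω : Fin M → κ => ∀ b ∈ S, ω b ≠ q b ω).card : ℝ) ≤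
      (1 - 1 / (Fintype.card κ : ℝ)) ^ S.card * (Fintype.card (Fin M → κ) : ℝ) := by
  obtain ⟨c⟩ := ‹Nonempty κ›
  have hpos : 0 < Fintype.card κ := Fintype.card_pos_iff.2 ⟨c⟩
  let φ : (Fin M → κ) → Fin M → κ := fun ω b => Equiv.swap (q b ω) c (ω b)
  have hφ : Function.Injective φ := by
    intro ω ω' h
    funext b
    induction b using WellFoundedLT.induction with
    | ind b ih =>
      have hb : Equiv.swap (q b ω) c (ω b) = Equiv.swap (q b ω') c (ω' b) := congrFun h b
      rw [hq b ω ω' ih] at hb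
      exact Equiv.injective _ hb
  have h1 : (Finset.univ.filter fun ω : Fin M → κ => ∀ b ∈ S, ω b ≠ q b ω).card ≤
      (Fintype.piFinset fun b : Fin M => if b ∈ S then Finset.univ.erase c else Finset.univ).card :=
    Finset.card_le_card_of_injOn φ (fun ω hω => by
      refine Finset.mem_coe.2 (Fintype.mem_piFinset.2 fun b => ?_)
      split_ifs with hb
      · refine Finset.mem_erase.2 ⟨fun h => (Finset.mem_filter.1 hω).2 b hb ?_, Finset.mem_univ _⟩
        rwa [Equiv.swap_apply_eq_iff, Equiv.swap_apply_right] at h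
      · exact Finset.mem_univ _) hφ.injOn
  have h2 : ((Fintype.piFinset fun b : Fin M =>
      if b ∈ S then Finset.univ.erase c else Finset.univ).card : ℝ) =
      (1 - 1 / (Fintype.card κ : ℝ)) ^ S.card * (Fintype.card (Fin M → κ) : ℝ) := by
    have hne : (Fintype.card κ : ℝ) ≠ 0 := by exact_mod_cast hpos.ne'
    rw [Fintype.card_piFinset, Nat.cast_prod]
    have : ∀ b : Fin M, (((if b ∈ S then Finset.univ.erase c else Finset.univ) :
        Finset κ).card : ℝ) =
        (if b ∈ S then (1 - 1 / (Fintype.card κ : ℝ)) else 1) * Fintype.card κ := by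
      intro b
      split_ifs
      · rw [Finset.card_erase_of_mem (Finset.mem_univ _), Finset.card_univ, Nat.cast_pred hpos]
        field_simp
      · rw [Finset.card_univ, one_mul]
    rw [Finset.prod_congr rfl fun b _ => this b, Finset.prod_mul_distrib, Finset.prod_ite_mem,
      Finset.univ_inter, Finset.prod_const, Finset.prod_const]
    simp
  rw [← h2]
  exact_mod_cast h1

/-! ### The random net tree -/

/-- The path of a leaf under the parent maps `g 0`, `g 1`, …. -/
def path {Y : Type*} (g : ℕ → Y → Y) (x : Y) : ℕ → Y
  | 0 => x
  | k + 1 => g k (path g x k)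

lemma path_eq_of_le {Y : Type*} {g : ℕ → Y → Y} {x y : Y} {k m : ℕ} (h : path g x k = path g y k)
    (hkm : k ≤ m) : path g x m = path g y m := by
  induction m, hkm using Nat.le_induction with
  | base => exact h
  | succ m _ ih => change g m _ = g m _; rw [ih]

section RandomTree

variable {X : Type*} [MetricSpace X]

/-- The net tree with parent maps `g k` at the heights `i₀ + k`, where `i₀` is the largest leaf
height. -/
def treeOfSteps (N : HierarchicalNet X) {i₀ : ℤ} (hi₀ : ∀ i, IsLeafHeight X i ↔ i ≤ i₀)
    (g : ℕ → X → X) (hg : ∀ k : ℕ, ∀ u ∈ N.net (i₀ + k), g k u ∈ N.net (i₀ + k + 1)) :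
    NetTree N where
  parent i u := if i < i₀ then u else g (i - i₀).toNat u
  parent_mem i u hu := by
    split_ifs with h
    · rw [N.net_leaf (i + 1) ((hi₀ _).2 (by omega))]
      trivial
    · have hi : i₀ + ((i - i₀).toNat : ℤ) = i := by omega
      have := hg (i - i₀).toNat u (by rwa [hi])
      rwa [hi] at this
  ancestor i x := path g x (i - i₀).toNat
  ancestor_leaf i hi x := by
    have : (i - i₀).toNat = 0 := by have := (hi₀ i).1 hi; omega
    rw [this]
    rfl
  ancestor_succ i x := by
    split_ifs with h
    · have h1 : (i + 1 - i₀).toNat = 0 := by omega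
      have h2 : (i - i₀).toNat = 0 := by omega
      rw [h1, h2]
    · have h1 : (i + 1 - i₀).toNat = (i - i₀).toNat + 1 := by omega
      rw [h1]
      rfl

/-- The choices from which the random tree is built: a nearby net point for every node, and
colourings of the nets in which points of one colour are far apart. -/
structure TreeData (N : HierarchicalNet X) (i₀ : ℤ) (κ : Type*) where
  near : ℤ → X → X
  near_mem : ∀ i, ∀ u ∈ N.net i, near i u ∈ N.net (i + 1)
  dist_near : ∀ i, ∀ u ∈ N.net i, dist u (near i u) ≤ (2 : ℝ) ^ (i + 1)
  col : ℤ → X → κ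
  col_inj : ∀ i, ∀ u ∈ N.net i, ∀ v ∈ N.net i, dist u v ≤ 7 * (2 : ℝ) ^ i →
    col i u = col i v → u = v

namespace TreeData

variable {N : HierarchicalNet X} {i₀ : ℤ} {κ : Type*} (D : TreeData N i₀ κ)

open Classical in
/-- The parent map that favours the colour `q`: net points of colour `q` attract every node within
`7 / 2` of the scale. -/
def pull (i : ℤ) (q : κ) (u : X) : X :=
  if h : ∃ v ∈ N.net (i + 1), D.col (i + 1) v = q ∧ dist u v ≤ 7 / 2 * (2 : ℝ) ^ (i + 1)
  then h.choose else D.near i u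

lemma pull_mem {i : ℤ} (q : κ) {u : X} (hu : u ∈ N.net i) : D.pull i q u ∈ N.net (i + 1) := by
  unfold pull
  split_ifs with h
  · exact h.choose_spec.1
  · exact D.near_mem i u hu

lemma dist_pull {i : ℤ} (q : κ) {u : X} (hu : u ∈ N.net i) :
    dist u (D.pull i q u) ≤ 7 / 2 * (2 : ℝ) ^ (i + 1) := by
  unfold pull
  split_ifs with h
  · exact h.choose_spec.2.2
  · have := D.dist_near i u hu
    have h2 : (0 : ℝ) < 2 ^ (i + 1) := by positivity
    linarith

lemma pull_eq {i : ℤ} {u v : X} (hv : v ∈ N.net (i + 1))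
    (huv : dist u v ≤ 7 / 2 * (2 : ℝ) ^ (i + 1)) : D.pull i (D.col (i + 1) v) u = v := by
  have h : ∃ v' ∈ N.net (i + 1), D.col (i + 1) v' = D.col (i + 1) v ∧
      dist u v' ≤ 7 / 2 * (2 : ℝ) ^ (i + 1) := ⟨v, hv, rfl, huv⟩
  unfold pull
  rw [dif_pos h]
  have hs := h.choose_spec
  refine D.col_inj _ _ hs.1 _ hv ?_ hs.2.1
  have := dist_triangle_left h.choose v u
  linarith

/-- The parent maps of the tree determined by the colours `ω`: each fifth map, starting with the
one out of height `i₀ + 4`, favours a colour, the others go to a nearby net point. The four maps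
in between keep the drift small enough for two nearby leaves to have a net point that can attract
both of their ancestors. -/
def step (ω : ℕ → κ) (k : ℕ) : X → X :=
  if k % 5 = 4 then D.pull (i₀ + k) (ω (k / 5)) else D.near (i₀ + k)

lemma step_mem (ω : ℕ → κ) (k : ℕ) {u : X} (hu : u ∈ N.net (i₀ + k)) :
    D.step ω k u ∈ N.net (i₀ + k + 1) := by
  unfold step
  split_ifs
  · exact D.pull_mem _ hu
  · exact D.near_mem _ u hu

lemma path_mem (h₀ : N.net i₀ = Set.univ) (ω : ℕ → κ) (x : X) (k : ℕ) :
    path (D.step ω) x k ∈ N.net (i₀ + k) := by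
  induction k with
  | zero => simp [h₀]
  | succ k ih =>
    have := D.step_mem ω k ih
    push_cast
    rwa [← add_assoc]

lemma path_congr {ω ω' : ℕ → κ} {b : ℕ} (h : ∀ b' < b, ω b' = ω' b') (x : X) {k : ℕ}
    (hk : k ≤ 5 * b + 4) : path (D.step ω) x k = path (D.step ω') x k := by
  induction k with
  | zero => rfl
  | succ k ih =>
    change D.step ω k (path (D.step ω) x k) = D.step ω' k (path (D.step ω') x k)
    rw [ih (by omega)]
    unfold step
    split_ifs with h4
    · rw [h (k / 5) (by omega)]
    · rfl

lemma dist_path_succ_of_ne (h₀ : N.net i₀ = Set.univ) (ω : ℕ → κ) (x : X) (k : ℕ)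
    (hk : k % 5 ≠ 4) : dist x (path (D.step ω) x (k + 1)) ≤
      dist x (path (D.step ω) x k) + (2 : ℝ) ^ i₀ * 2 ^ (k + 1) := by
  refine (dist_triangle _ (path (D.step ω) x k) _).trans (add_le_add le_rfl ?_)
  have h := D.dist_near _ _ (D.path_mem h₀ ω x k)
  rw [add_assoc, zpow_add₀ (by norm_num)] at h
  change dist _ (D.step ω k _) ≤ _
  rw [step, if_neg hk]
  exact_mod_cast h

lemma dist_path_succ (h₀ : N.net i₀ = Set.univ) (ω : ℕ → κ) (x : X) (k : ℕ) :
    dist x (path (D.step ω) x (k + 1)) ≤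
      dist x (path (D.step ω) x k) + 7 / 2 * ((2 : ℝ) ^ i₀ * 2 ^ (k + 1)) := by
  by_cases hk : k % 5 = 4
  · refine (dist_triangle _ (path (D.step ω) x k) _).trans (add_le_add le_rfl ?_)
    have h := D.dist_pull (ω (k / 5)) (D.path_mem h₀ ω x k)
    rw [add_assoc, zpow_add₀ (by norm_num)] at h
    change dist _ (D.step ω k _) ≤ _
    rw [step, if_pos hk]
    exact_mod_cast h
  · have := D.dist_path_succ_of_ne h₀ ω x k hk
    have h2 : (0 : ℝ) < 2 ^ i₀ * 2 ^ (k + 1) := by positivity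
    linarith

/-- The drift within a block of five heights, in units of the scale at its bottom. -/
lemma dist_path_block (h₀ : N.net i₀ = Set.univ) (ω : ℕ → κ) (x : X) (b : ℕ)
    (h : dist x (path (D.step ω) x (5 * b)) ≤ 5 * ((2 : ℝ) ^ i₀ * 2 ^ (5 * b))) :
    dist x (path (D.step ω) x (5 * b + 1)) ≤ 7 * ((2 : ℝ) ^ i₀ * 2 ^ (5 * b)) ∧
    dist x (path (D.step ω) x (5 * b + 2)) ≤ 11 * ((2 : ℝ) ^ i₀ * 2 ^ (5 * b)) ∧
    dist x (path (D.step ω) x (5 * b + 3)) ≤ 19 * ((2 : ℝ) ^ i₀ * 2 ^ (5 * b)) ∧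
    dist x (path (D.step ω) x (5 * b + 4)) ≤ 35 * ((2 : ℝ) ^ i₀ * 2 ^ (5 * b)) := by
  have h1 := D.dist_path_succ_of_ne h₀ ω x (5 * b) (by omega)
  have h2 := D.dist_path_succ_of_ne h₀ ω x (5 * b + 1) (by omega)
  have h3 := D.dist_path_succ_of_ne h₀ ω x (5 * b + 2) (by omega)
  have h4 := D.dist_path_succ_of_ne h₀ ω x (5 * b + 3) (by omega)
  simp only [pow_succ (2 : ℝ)] at h1 h2 h3 h4
  refine ⟨by linarith, by linarith, by linarith, by linarith⟩

lemma dist_path_mul (h₀ : N.net i₀ = Set.univ) (ω : ℕ → κ) (x : X) (b : ℕ) :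
    dist x (path (D.step ω) x (5 * b)) ≤ 5 * ((2 : ℝ) ^ i₀ * 2 ^ (5 * b)) := by
  induction b with
  | zero => simp [path]; positivity
  | succ b ih =>
    have h1 := (D.dist_path_block h₀ ω x b ih).2.2.2
    have h2 := D.dist_path_succ h₀ ω x (5 * b + 4)
    rw [show 5 * (b + 1) = 5 * b + 4 + 1 by ring]
    simp only [pow_succ (2 : ℝ)] at h2 ⊢
    have h3 : (0 : ℝ) < 2 ^ i₀ * 2 ^ (5 * b) := by positivity
    linarith

lemma dist_path (h₀ : N.net i₀ = Set.univ) (ω : ℕ → κ) (x : X) (k : ℕ) :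
    dist x (path (D.step ω) x k) ≤ 5 * ((2 : ℝ) ^ i₀ * 2 ^ k) := by
  have h := D.dist_path_mul h₀ ω x (k / 5)
  obtain ⟨h1, h2, h3, h4⟩ := D.dist_path_block h₀ ω x (k / 5) h
  have hpos : (0 : ℝ) < 2 ^ i₀ * 2 ^ (5 * (k / 5)) := by positivity
  have hk : k = 5 * (k / 5) ∨ k = 5 * (k / 5) + 1 ∨ k = 5 * (k / 5) + 2 ∨ k = 5 * (k / 5) + 3 ∨
      k = 5 * (k / 5) + 4 := by omega
  generalize k / 5 = b at *
  rcases hk with rfl | rfl | rfl | rfl | rfl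
  · exact h
  all_goals
    simp only [pow_succ (2 : ℝ)]
    linarith

/-- The colour that makes the paths of two nearby leaves meet at the end of block `b`: that of a
net point close to the ancestor of the first one. It depends on the earlier colours only. -/
def goodColor (x : X) (b : ℕ) (ω : ℕ → κ) : κ :=
  D.col (i₀ + (5 * b + 4 : ℕ) + 1) (D.near (i₀ + (5 * b + 4 : ℕ)) (path (D.step ω) x (5 * b + 4)))

lemma path_eq_of_goodColor (h₀ : N.net i₀ = Set.univ) {ω : ℕ → κ} {x y : X} {b : ℕ}
    (hxy : dist x y ≤ (2 : ℝ) ^ i₀ * 2 ^ (5 * b)) (hω : ω b = D.goodColor x b ω) :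
    path (D.step ω) x (5 * b + 5) = path (D.step ω) y (5 * b + 5) := by
  have hx := (D.dist_path_block h₀ ω x b (D.dist_path_mul h₀ ω x b)).2.2.2
  have hy := (D.dist_path_block h₀ ω y b (D.dist_path_mul h₀ ω y b)).2.2.2
  have hnear := D.dist_near _ _ (D.path_mem h₀ ω x (5 * b + 4))
  have hmem := D.near_mem _ _ (D.path_mem h₀ ω x (5 * b + 4))
  change D.step ω (5 * b + 4) _ = D.step ω (5 * b + 4) _
  rw [step, if_pos (by omega), show (5 * b + 4) / 5 = b by omega, hω]
  have hscale : (2 : ℝ) ^ (i₀ + (5 * b + 4 : ℕ) + 1) = 32 * (2 ^ i₀ * 2 ^ (5 * b)) := by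
    rw [zpow_add₀ (by norm_num), zpow_add₀ (by norm_num), zpow_natCast, zpow_one, pow_add]
    ring
  have hpos : (0 : ℝ) < 2 ^ i₀ * 2 ^ (5 * b) := by positivity
  unfold goodColor
  rw [D.pull_eq hmem (by rw [hscale] at hnear ⊢; linarith), D.pull_eq hmem ?_]
  rw [hscale] at hnear ⊢
  have h1 := dist_triangle4 (path (D.step ω) y (5 * b + 4)) y (path (D.step ω) x (5 * b + 4))
    (D.near (i₀ + (5 * b + 4 : ℕ)) (path (D.step ω) x (5 * b + 4)))
  rw [dist_comm _ y] at h1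
  have h2 := dist_triangle_left y (path (D.step ω) x (5 * b + 4)) x
  linarith

/-- The tree determined by the colours `ω`. -/
def tree (hi₀ : ∀ i, IsLeafHeight X i ↔ i ≤ i₀) (ω : ℕ → κ) : NetTree N :=
  treeOfSteps N hi₀ (D.step ω) fun k _ hu => D.step_mem ω k hu

lemma smallDrift_tree (hi₀ : ∀ i, IsLeafHeight X i ↔ i ≤ i₀) (ω : ℕ → κ) :
    (D.tree hi₀ ω).SmallDrift := by
  intro i x
  by_cases h : i ≤ i₀
  · rw [NetTree.ancestor_leaf _ i ((hi₀ i).2 h), dist_self]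
    positivity
  · have h1 := D.dist_path (N.net_leaf i₀ ((hi₀ i₀).2 le_rfl)) ω x (i - i₀).toNat
    rw [← zpow_natCast, ← zpow_add₀ (by norm_num),
      show i₀ + ((i - i₀).toNat : ℤ) = i by omega] at h1
    exact h1

end TreeData

end RandomTree

section RandomTree

variable {X : Type*} [MetricSpace X]

lemma exists_treeData [Finite X] (N : HierarchicalNet X) (i₀ : ℤ) {t : ℝ}
    (h : HalfCovering X t) {A : ℕ} (hA : 0 < A) (hAt : ((2 : ℝ) ^ t) ^ 5 < A + 1) :
    Nonempty (TreeData N i₀ (Fin A)) := by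
  choose near hmem hdist using fun (i : ℤ) (u : X) =>
    show ∃ v, u ∈ N.net i → (v ∈ N.net (i + 1) ∧ dist u v ≤ (2 : ℝ) ^ (i + 1)) by
      by_cases hu : u ∈ N.net i
      · obtain ⟨v, hv⟩ := (N.isNet i).2.2 u hu
        exact ⟨v, fun _ => hv⟩
      · exact ⟨u, fun hu' => absurd hu' hu⟩
  choose col hcol using fun i : ℤ => exists_coloring (N.net i) (ρ := 7 * (2 : ℝ) ^ i)
    (by positivity) hA fun x _ F hF hFd => by
      have h1 := h.card_le 5 x (ρ := (2 : ℝ) ^ i) (by positivity) F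
        (fun a ha b hb hab => N.le_dist (hF ha) (hF hb) hab) fun a ha => by
          have := hFd a ha
          have hpos : (0 : ℝ) < 2 ^ i := by positivity
          linarith
      exact Nat.lt_succ_iff.1 (by exact_mod_cast h1.trans_lt hAt)
  exact ⟨⟨near, hmem, hdist, col, hcol⟩⟩

namespace TreeData

variable {N : HierarchicalNet X} {i₀ : ℤ} {κ : Type*} (D : TreeData N i₀ κ)

/-- A finite word of colours, continued by a fixed colour. -/
def extend [Nonempty κ] {M : ℕ} (ω : Fin M → κ) (b : ℕ) : κ :=
  if h : b < M then ω ⟨b, h⟩ else Classical.arbitrary κ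

open Classical in
/-- Two leaves that are still apart `ℓ` blocks above the scale of their distance have escaped
the good colour `ℓ` times, which a fraction of at most `(1 - 1 / |κ|) ^ ℓ` of the words does. -/
lemma card_path_ne_le [Fintype κ] [Nonempty κ] (h₀ : N.net i₀ = Set.univ) {M : ℕ} {x y : X}
    {b₀ ℓ : ℕ} (hM : b₀ + ℓ ≤ M) (hxy : dist x y ≤ (2 : ℝ) ^ i₀ * 2 ^ (5 * b₀)) :
    ((Finset.univ.filter fun ω : Fin M → κ =>
      path (D.step (extend ω)) x (5 * (b₀ + ℓ)) ≠ path (D.step (extend ω)) y (5 * (b₀ + ℓ))).card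
        : ℝ) ≤
      (1 - 1 / (Fintype.card κ : ℝ)) ^ ℓ * (Fintype.card (Fin M → κ) : ℝ) := by
  let S : Finset (Fin M) := (Finset.Ico b₀ (b₀ + ℓ)).attachFin fun b hb =>
    (Finset.mem_Ico.1 hb).2.trans_le hM
  have hS : S.card = ℓ := by simp [S, Finset.card_attachFin]
  have hext : ∀ (ω : Fin M → κ) (b : Fin M), extend ω b = ω b := fun ω b => by
    simp [extend]
  have key := card_avoid_le (fun (b : Fin M) (ω : Fin M → κ) => D.goodColor x b (extend ω))
    (fun b ω ω' h => by
      simp only [goodColor]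
      rw [D.path_congr (fun b' hb' => ?_) x le_rfl]
      have hb'M : b' < M := hb'.trans b.2
      have := h ⟨b', hb'M⟩ hb'
      simpa [extend, hb'M] using this) S
  rw [hS] at key
  refine le_trans ?_ key
  norm_cast
  refine Finset.card_le_card fun ω hω => ?_
  refine Finset.mem_filter.2 ⟨Finset.mem_univ _, fun b hb heq => (Finset.mem_filter.1 hω).2 ?_⟩
  have hb' := Finset.mem_Ico.1 (Finset.mem_attachFin _ |>.1 hb)
  refine path_eq_of_le (k := 5 * b + 5) (D.path_eq_of_goodColor h₀ (hxy.trans ?_) ?_) (by omega)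
  · gcongr
    · norm_num
    · exact hb'.1
  · rw [hext, heq]

open Classical in
/-- The union bound over the pairs in `H`. -/
lemma card_not_mergesWithin_le [Fintype κ] [Nonempty κ]
    (hi₀ : ∀ i, IsLeafHeight X i ↔ i ≤ i₀) {M : ℕ}
    (hM : ∀ x y : X, dist x y < (2 : ℝ) ^ (i₀ + (5 * M : ℕ))) (H : Finset X) (ℓ : ℕ) :
    ((Finset.univ.filter fun ω : Fin M → κ =>
      ¬ (D.tree hi₀ (extend ω)).MergesWithin H (5 * ℓ + 5)).card : ℝ) ≤
      (H.card : ℝ) ^ 2 * (1 - 1 / (Fintype.card κ : ℝ)) ^ ℓ *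
        (Fintype.card (Fin M → κ) : ℝ) := by
  have h₀ : N.net i₀ = Set.univ := N.net_leaf i₀ ((hi₀ i₀).2 le_rfl)
  -- The block at the scale of the distance.
  let b₀ : X → X → ℕ := fun x y => (Int.log 2 (dist x y) - i₀).toNat / 5 + 1
  let W : X × X → Finset (Fin M → κ) := fun p =>
    if b₀ p.1 p.2 + ℓ ≤ M ∧ p.1 ≠ p.2 then
      Finset.univ.filter fun ω : Fin M → κ =>
        path (D.step (extend ω)) p.1 (5 * (b₀ p.1 p.2 + ℓ)) ≠
          path (D.step (extend ω)) p.2 (5 * (b₀ p.1 p.2 + ℓ))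
    else ∅
  have hlog : ∀ x y : X, x ≠ y → i₀ ≤ Int.log 2 (dist x y) := fun x y hxy => by
    rw [← Int.zpow_le_iff_le_log (by norm_num) (dist_pos.2 hxy)]
    exact_mod_cast (hi₀ i₀).2 le_rfl x y hxy
  have hκ : 0 ≤ 1 - 1 / (Fintype.card κ : ℝ) := by
    have : (1 : ℝ) ≤ Fintype.card κ := by exact_mod_cast Fintype.card_pos (α := κ)
    rw [sub_nonneg]
    exact div_le_one_of_le₀ this (by positivity)
  have hW : ∀ p, ((W p).card : ℝ) ≤
      (1 - 1 / (Fintype.card κ : ℝ)) ^ ℓ * (Fintype.card (Fin M → κ) : ℝ) := by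
    intro p
    by_cases hp : b₀ p.1 p.2 + ℓ ≤ M ∧ p.1 ≠ p.2
    · simp only [W, if_pos hp]
      refine D.card_path_ne_le h₀ hp.1 ?_
      have h1 := Int.lt_zpow_succ_log_self (b := 2) (by norm_num) (dist p.1 p.2)
      push_cast at h1
      rw [← zpow_natCast, ← zpow_add₀ (by norm_num)]
      refine h1.le.trans (zpow_le_zpow_right₀ (by norm_num) ?_)
      have := hlog _ _ hp.2
      simp only [b₀]
      omega
    · simp only [W, if_neg hp, Finset.card_empty, Nat.cast_zero]
      positivity
  have hsub : (Finset.univ.filter fun ω : Fin M → κ =>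
      ¬ (D.tree hi₀ (extend ω)).MergesWithin H (5 * ℓ + 5)) ⊆ (H ×ˢ H).biUnion W := by
    intro ω hω
    have hω' := (Finset.mem_filter.1 hω).2
    unfold NetTree.MergesWithin at hω'
    push Not at hω'
    obtain ⟨x, hx, y, hy, hxy, j, hj, hne⟩ := hω'
    refine Finset.mem_biUnion.2 ⟨(x, y), Finset.mk_mem_product hx hy, ?_⟩
    change path (D.step (extend ω)) x (j - i₀).toNat ≠
      path (D.step (extend ω)) y (j - i₀).toNat at hne
    have hlo := hlog x y hxy
    have hle : 5 * (b₀ x y + ℓ) ≤ (j - i₀).toNat := by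
      simp only [b₀]
      push_cast at hj
      omega
    have hne' := mt (fun e => path_eq_of_le e hle) hne
    have hbM : b₀ x y + ℓ ≤ M := by
      by_contra! hlt
      refine hne' (path_eq_of_le (k := 5 * M) ?_ (by omega))
      by_contra hne''
      exact absurd (hM _ _) (not_lt.2 (N.le_dist (D.path_mem h₀ _ x _) (D.path_mem h₀ _ y _)
        hne''))
    simp only [W, if_pos (show b₀ x y + ℓ ≤ M ∧ x ≠ y from ⟨hbM, hxy⟩)]
    exact Finset.mem_filter.2 ⟨Finset.mem_univ _, hne'⟩
  calc _ ≤ (((H ×ˢ H).biUnion W).card : ℝ) := by exact_mod_cast Finset.card_le_card hsub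
    _ ≤ ∑ p ∈ H ×ˢ H, ((W p).card : ℝ) := by exact_mod_cast Finset.card_biUnion_le
    _ ≤ ∑ p ∈ H ×ˢ H, (1 - 1 / (Fintype.card κ : ℝ)) ^ ℓ * (Fintype.card (Fin M → κ) : ℝ) :=
      Finset.sum_le_sum fun p _ => hW p
    _ = _ := by
      rw [Finset.sum_const, Finset.card_product, nsmul_eq_mul]
      push_cast
      ring

end TreeData

/-- The random net tree: all colours are independent and uniformly distributed. -/
theorem exists_random_netTree [Finite X] [Nontrivial X] {t : ℝ} (h : HalfCovering X t) {A : ℕ}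
    (hA : 0 < A) (hAt : ((2 : ℝ) ^ t) ^ 5 < A + 1) :
    ∃ (i₀ : ℤ) (N : HierarchicalNet X) (P : PMF (NetTree N)), IsLeafHeight X i₀ ∧
      (∀ T ∈ P.support, T.SmallDrift) ∧ ∀ (H : Finset X) (ℓ : ℕ),
        ENNReal.ofReal (1 - (H.card : ℝ) ^ 2 * (1 - 1 / (A : ℝ)) ^ ℓ) ≤
          P.toOuterMeasure {T | T.SmallDrift ∧ T.MergesWithin H (5 * ℓ + 5)} := by
  classical
  obtain ⟨i₀, hi₀⟩ := exists_isLeafHeight_iff (X := X)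
  obtain ⟨N⟩ := exists_hierarchicalNet hi₀
  obtain ⟨D⟩ := exists_treeData N i₀ h hA hAt
  have : Nonempty (Fin A) := ⟨⟨0, hA⟩⟩
  -- Above height `i₀ + 5 * M` the nets are single points.
  obtain ⟨M, hM⟩ : ∃ M : ℕ, ∀ x y : X, dist x y < (2 : ℝ) ^ (i₀ + (5 * M : ℕ)) := by
    obtain ⟨p, hp⟩ := Finite.exists_max fun p : X × X => dist p.1 p.2
    obtain ⟨M, hM⟩ := pow_unbounded_of_one_lt (dist p.1 p.2 / (2 : ℝ) ^ i₀)
      (by norm_num : (1 : ℝ) < 2)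
    refine ⟨M, fun x y => (hp (x, y)).trans_lt ?_⟩
    rw [zpow_add₀ (by norm_num), zpow_natCast]
    rw [div_lt_iff₀' (by positivity)] at hM
    refine hM.trans_le ?_
    gcongr
    · norm_num
    · omega
  let tr : (Fin M → Fin A) → NetTree N := fun ω => D.tree hi₀ (TreeData.extend ω)
  refine ⟨i₀, N, (PMF.uniformOfFintype (Fin M → Fin A)).map tr, (hi₀ _).2 le_rfl, ?_, ?_⟩
  · intro T hT
    obtain ⟨ω, _, rfl⟩ := (PMF.mem_support_map_iff _ _ _).1 hT
    exact D.smallDrift_tree hi₀ _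
  · intro H ℓ
    rw [PMF.toOuterMeasure_map_apply, PMF.toOuterMeasure_uniformOfFintype_apply]
    have hbad := D.card_not_mergesWithin_le hi₀ hM H ℓ
    have hcard : Fintype.card ↑(tr ⁻¹' {T | T.SmallDrift ∧ T.MergesWithin H (5 * ℓ + 5)}) =
        (Finset.univ.filter fun ω => (tr ω).MergesWithin H (5 * ℓ + 5)).card := by
      rw [Fintype.card_subtype]
      congr 1
      ext ω
      simp only [Set.mem_preimage, Set.mem_ofPred_eq, Finset.mem_filter, Finset.mem_univ, true_and]
      exact ⟨fun h => h.2, fun h => ⟨D.smallDrift_tree hi₀ _, h⟩⟩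
    have hsum := Finset.card_filter_add_card_filter_not (s := (Finset.univ : Finset (Fin M → Fin A)))
      (fun ω => (tr ω).MergesWithin H (5 * ℓ + 5))
    rw [hcard]
    have hpos : (0 : ℝ) < Fintype.card (Fin M → Fin A) := by exact_mod_cast Fintype.card_pos
    rw [← ENNReal.ofReal_natCast, ← ENNReal.ofReal_natCast, ← ENNReal.ofReal_div_of_pos hpos]
    refine ENNReal.ofReal_le_ofReal ?_
    rw [le_div_iff₀ hpos]
    rw [Finset.card_univ] at hsum
    have hsum' := congrArg (Nat.cast (R := ℝ)) hsum
    rw [Nat.cast_add] at hsum'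
    rw [Fintype.card_fin] at hbad
    simp only [tr] at hsum' ⊢
    linarith

end RandomTree

/-! ### Quantitative estimates -/

/-- The four summands are the bounds of `SmallDrift.ncard_ranges_le`, with `K = L + e + 2` heights in
the first kind of centres. -/
lemma count_le {n V K : ℕ} (hn : 1 ≤ n) (hV : 1 ≤ V) (hK : 1 ≤ K) :
    n * (n + 1) + (n + 1) + n * (n * (V * ((n + 1) * (n + 1)))) + n * (n * (K * (V * (n + 1)))) ≤
      16 * (V * K * n ^ 4) := by
  have h1 : n + 1 ≤ 2 * n := by omega
  have hVK : 1 ≤ V * K := Nat.mul_pos hV hK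
  have hp : ∀ i ≤ 4, n ^ i ≤ n ^ 4 := fun i hi => Nat.pow_le_pow_right hn hi
  have a1 : n * (n + 1) ≤ 2 * (V * K * n ^ 4) := calc
    n * (n + 1) ≤ n * (2 * n) := by gcongr
    _ = 2 * (1 * n ^ 2) := by ring
    _ ≤ _ := by gcongr; norm_num
  have a2 : n + 1 ≤ 2 * (V * K * n ^ 4) := calc
    n + 1 ≤ 2 * (1 * n ^ 1) := by rw [pow_one]; omega
    _ ≤ _ := by gcongr; norm_num
  have a3 : n * (n * (V * ((n + 1) * (n + 1)))) ≤ 4 * (V * K * n ^ 4) := calc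
    _ ≤ n * (n * (V * ((2 * n) * (2 * n)))) := by gcongr
    _ = 4 * (V * 1 * n ^ 4) := by ring
    _ ≤ _ := by gcongr
  have a4 : n * (n * (K * (V * (n + 1)))) ≤ 2 * (V * K * n ^ 4) := calc
    _ ≤ n * (n * (K * (V * (2 * n)))) := by gcongr
    _ = 2 * (V * K * n ^ 3) := by ring
    _ ≤ _ := by gcongr; norm_num
  omega

lemma half_le_log_div {n : ℕ} (hn : 2 ≤ n) {τ : ℝ} (hτ : 0 < τ) (hτ' : τ < 1) :
    1 / 2 ≤ Real.log (n / τ) := by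
  have h2 : (2 : ℝ) ≤ n := by exact_mod_cast hn
  have h : (2 : ℝ) ≤ n / τ := by
    rw [le_div_iff₀ hτ]
    linarith
  linarith [Real.log_two_gt_d9, Real.log_le_log (by norm_num) h]

/-- The number of blocks after which the probability of an unmerged pair is at most `τ`. -/
lemma exists_blocks {n A : ℕ} (hn : 2 ≤ n) (hA : 0 < A) {τ : ℝ} (hτ : 0 < τ) (hτ' : τ < 1) :
    ∃ ℓ : ℕ, (n : ℝ) ^ 2 * (1 - 1 / (A : ℝ)) ^ ℓ ≤ τ ∧ (ℓ : ℝ) ≤ 4 * A * Real.log (n / τ) := by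
  have hA' : (1 : ℝ) ≤ A := by exact_mod_cast hA
  have hn' : (2 : ℝ) ≤ n := by exact_mod_cast hn
  have hlg := half_le_log_div hn hτ hτ'
  have hle : Real.log ((n : ℝ) ^ 2 / τ) ≤ 2 * Real.log (n / τ) := by
    rw [Real.log_div (by positivity) hτ.ne', Real.log_div (by positivity) hτ.ne', Real.log_pow]
    push_cast
    linarith [Real.log_neg hτ hτ']
  have hpos : 0 ≤ Real.log ((n : ℝ) ^ 2 / τ) := by
    apply Real.log_nonneg
    rw [le_div_iff₀ hτ]
    nlinarith
  refine ⟨⌈A * Real.log ((n : ℝ) ^ 2 / τ)⌉₊, ?_, ?_⟩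
  · set ℓ := ⌈A * Real.log ((n : ℝ) ^ 2 / τ)⌉₊
    have hℓ : A * Real.log ((n : ℝ) ^ 2 / τ) ≤ ℓ := Nat.le_ceil _
    have h1 : (1 - 1 / (A : ℝ)) ^ ℓ ≤ Real.exp (-(ℓ / A)) := by
      rw [show -((ℓ : ℝ) / A) = ℓ * (-(1 / A)) by ring, Real.exp_nat_mul]
      refine pow_le_pow_left₀ ?_ ?_ _
      · rw [sub_nonneg]
        exact div_le_one_of_le₀ hA' (by positivity)
      · linarith [Real.add_one_le_exp (-(1 / (A : ℝ)))]
    have h2 : Real.exp (-(ℓ / A)) ≤ τ / n ^ 2 := by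
      rw [← Real.exp_log (show 0 < τ / (n : ℝ) ^ 2 by positivity), Real.exp_le_exp,
        ← inv_div ((n : ℝ) ^ 2) τ, Real.log_inv, neg_le_neg_iff, le_div_iff₀ (by positivity)]
      linarith
    calc (n : ℝ) ^ 2 * (1 - 1 / (A : ℝ)) ^ ℓ ≤ n ^ 2 * (τ / n ^ 2) := by gcongr; exact h1.trans h2
      _ = τ := by field_simp
  · have := Nat.ceil_lt_add_one (show 0 ≤ A * Real.log ((n : ℝ) ^ 2 / τ) by positivity)
    nlinarith

/-- A power of two serves as the threshold `1 / ε + 10` of `SmallDrift.mem_sepSet`, so that all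
heights are dyadic logarithms shifted by integers. -/
lemma exists_dyadic {ε : ℝ} (hε : 0 < ε) (hε' : ε ≤ 1 / 16) :
    ∃ e : ℕ, 1 / ε + 10 ≤ 2 ^ e ∧ (2 : ℝ) ^ e ≤ 4 / ε := by
  have h16 : 16 ≤ 1 / ε := by
    rw [le_div_iff₀ hε]
    linarith
  obtain ⟨m, hm, hm'⟩ := exists_nat_pow_near (x := 1 / ε + 10) (y := (2 : ℝ)) (by linarith)
    (by norm_num)
  refine ⟨m + 1, hm'.le, ?_⟩
  rw [pow_succ, show 4 / ε = 4 * (1 / ε) by ring]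
  linarith

/-- The count in terms of `δ`, the doubling dimension. The factors `V` and `A` are `t`-th powers of
quantities polynomial in `1 / ε`, and the number `ℓ` of blocks contributes the logarithm `lg`. -/
lemma bound_le {n V A e ℓ : ℕ} {t δ ε lg : ℝ} (hδ : 1 ≤ δ) (ht : 1 ≤ t) (htδ : t ≤ 2 * δ)
    (hε : 0 < ε) (hε' : ε ≤ 1 / 16) (he : (2 : ℝ) ^ e ≤ 4 / ε) (hA : 1 ≤ A)
    (hAt : (A : ℝ) ≤ ((2 : ℝ) ^ t) ^ 5) (hV : (V : ℝ) ≤ ((2 : ℝ) ^ t) ^ (e + 4))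
    (hlg : 1 / 2 ≤ lg) (hℓ : (ℓ : ℝ) ≤ 4 * A * lg) :
    (16 * (V * (5 * ℓ + 5 + e + 2) * n ^ 4) : ℝ) ≤ (2048 / ε) ^ (4 * δ) * lg * n ^ 4 := by
  have hA1 : (1 : ℝ) ≤ A := by exact_mod_cast hA
  have he1 : (1 : ℝ) ≤ 2 ^ e := one_le_pow₀ (by norm_num)
  have hee : (e : ℝ) ≤ 2 ^ e := by exact_mod_cast (Nat.lt_two_pow_self (n := e)).le
  have hbase : (1 : ℝ) ≤ 2048 / ε := by
    rw [le_div_iff₀ hε]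
    linarith
  have h1 : (5 * ℓ + 5 + e + 2 : ℝ) ≤ 36 * (A * 2 ^ e) * lg := by
    have a1 : (A : ℝ) ≤ A * 2 ^ e := by nlinarith
    have a2 : (2 : ℝ) ^ e ≤ A * 2 ^ e := by nlinarith
    have a3 : (7 + e : ℝ) ≤ 8 * (A * 2 ^ e) := by linarith
    have a4 : (7 + e : ℝ) ≤ 16 * (A * 2 ^ e) * lg := by nlinarith
    have a5 : (A : ℝ) * lg ≤ A * 2 ^ e * lg := by gcongr
    linarith
  have h2 : (V : ℝ) * A ≤ (2048 / ε) ^ (2 * δ) := calc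
    (V : ℝ) * A ≤ ((2 : ℝ) ^ t) ^ (e + 4) * ((2 : ℝ) ^ t) ^ 5 := by gcongr
    _ = ((2 : ℝ) ^ t) ^ (e + 9) := by rw [← pow_add]
    _ = ((2 : ℝ) ^ (e + 9)) ^ t := by
      rw [← Real.rpow_natCast, ← Real.rpow_natCast, ← Real.rpow_mul (by norm_num),
        ← Real.rpow_mul (by norm_num), mul_comm]
    _ ≤ (2048 / ε) ^ t := by
      refine Real.rpow_le_rpow (by positivity) ?_ (by linarith)
      rw [pow_add, show 2048 / ε = 4 / ε * 2 ^ 9 by ring]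
      gcongr
    _ ≤ _ := Real.rpow_le_rpow_of_exponent_le hbase htδ
  have h3 : (576 : ℝ) * 2 ^ e ≤ (2048 / ε) ^ (2 * δ) := calc
    (576 : ℝ) * 2 ^ e ≤ 576 * (4 / ε) := by gcongr
    _ ≤ (2048 / ε) * (2048 / ε) := by
      rw [show 576 * (4 / ε) = 9 / 8 * (2048 / ε) by ring]
      have h16 : 9 / 8 ≤ 2048 / ε := by
        rw [le_div_iff₀ hε]
        linarith
      gcongr
    _ = (2048 / ε) ^ (2 : ℝ) := by rw [Real.rpow_two, sq]
    _ ≤ _ := Real.rpow_le_rpow_of_exponent_le hbase (by linarith)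
  calc (16 * (V * (5 * ℓ + 5 + e + 2) * n ^ 4) : ℝ)
      ≤ 16 * (V * (36 * (A * 2 ^ e) * lg) * n ^ 4) := by gcongr
    _ = (V * A) * (576 * 2 ^ e) * lg * n ^ 4 := by ring
    _ ≤ (2048 / ε) ^ (2 * δ) * (2048 / ε) ^ (2 * δ) * lg * n ^ 4 := by gcongr
    _ = _ := by
      rw [← Real.rpow_add (by linarith)]
      ring_nf

/-- Passing from a bound with a logarithm to a pure power of `n`. -/
lemma exists_exponent {δ ε τ : ℝ} (hδ : 1 ≤ δ) (hε : 0 < ε) (hε' : ε ≤ 1 / 16) (hτ : 0 < τ)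
    (hτ' : τ < 1) : ∃ k : ℕ,
      (∀ n : ℕ, 2 ≤ n → (2048 / ε) ^ (4 * δ) * Real.log (n / τ) * n ^ 4 ≤ (n : ℝ) ^ k) ∧
      (k : ℝ) ≤ 2048 * (δ * Real.log (1 / ε) + max 0 (Real.log (Real.log (1 / τ)))) := by
  set m := max 0 (Real.log (Real.log (1 / τ)))
  have hm : 0 ≤ m := le_max_left _ _
  have hlτ : 0 < Real.log (1 / τ) := Real.log_pos (by rw [lt_div_iff₀ hτ]; linarith)
  have hlτm : Real.log (1 / τ) ≤ Real.exp m := by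
    rw [← Real.log_le_iff_le_exp hlτ]
    exact le_max_right _ _
  have hm1 : 1 ≤ Real.exp m := Real.one_le_exp hm
  have hY : 0 < (2048 / ε) ^ (4 * δ) := by positivity
  set Y := (2048 / ε) ^ (4 * δ)
  have hZ : 0 < Y * (2 * Real.exp m) := by positivity
  refine ⟨⌈2 * Real.log (Y * (2 * Real.exp m))⌉₊ + 5, fun n hn => ?_, ?_⟩
  · set k := ⌈2 * Real.log (Y * (2 * Real.exp m))⌉₊
    have hn' : (2 : ℝ) ≤ n := by exact_mod_cast hn
    have hlog : Real.log (n / τ) ≤ 2 * Real.exp m * n := by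
      rw [Real.log_div (by positivity) hτ.ne']
      rw [one_div, Real.log_inv] at hlτm
      have := Real.log_le_sub_one_of_pos (show (0 : ℝ) < n by positivity)
      nlinarith
    have hk : Y * (2 * Real.exp m) ≤ (n : ℝ) ^ k := by
      rw [← Real.log_le_log_iff hZ (by positivity), Real.log_pow]
      have h1 : 2 * Real.log (Y * (2 * Real.exp m)) ≤ k := Nat.le_ceil _
      have h2 : 1 / 2 ≤ Real.log n := by
        linarith [Real.log_two_gt_d9, Real.log_le_log (by norm_num) hn']
      have h3 : (0 : ℝ) ≤ k := by positivity
      nlinarith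
    calc Y * Real.log (n / τ) * n ^ 4 ≤ Y * (2 * Real.exp m * n) * n ^ 4 := by gcongr
      _ = Y * (2 * Real.exp m) * n ^ 5 := by ring
      _ ≤ (n : ℝ) ^ k * n ^ 5 := by gcongr
      _ = _ := by rw [pow_add]
  · have hlε : 4 * Real.log 2 ≤ Real.log (1 / ε) := by
      rw [show 4 * Real.log 2 = Real.log (2 ^ 4) by rw [Real.log_pow]; norm_num]
      refine Real.log_le_log (by norm_num) ?_
      rw [le_div_iff₀ hε]
      linarith
    have hlogY : Real.log (Y * (2 * Real.exp m)) =
        4 * δ * (11 * Real.log 2 + Real.log (1 / ε)) + (Real.log 2 + m) := by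
      rw [Real.log_mul hY.ne' (by positivity), Real.log_mul (by norm_num) (by positivity),
        Real.log_exp, Real.log_rpow (by positivity), show (2048 : ℝ) / ε = 2 ^ 11 * (1 / ε) by ring,
        Real.log_mul (by norm_num) (by positivity), Real.log_pow]
      norm_num
    have hl2 := Real.log_two_gt_d9
    have hl2' := Real.log_two_lt_d9
    have h1 : 2 * Real.log (Y * (2 * Real.exp m)) ≤ 32 * (δ * Real.log (1 / ε)) + 2 + 2 * m := by
      rw [hlogY]
      have : δ * (11 * Real.log 2 + Real.log (1 / ε)) ≤ δ * (4 * Real.log (1 / ε)) := by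
        gcongr
        linarith
      linarith
    have h2 : 2 ≤ δ * Real.log (1 / ε) := by nlinarith
    have h3 : (⌈2 * Real.log (Y * (2 * Real.exp m))⌉₊ : ℝ) ≤
        32 * (δ * Real.log (1 / ε)) + 2 + 2 * m + 1 := by
      have : ⌈2 * Real.log (Y * (2 * Real.exp m))⌉₊ ≤ ⌈32 * (δ * Real.log (1 / ε)) + 2 + 2 * m⌉₊ :=
        Nat.ceil_le_ceil h1
      exact (Nat.cast_le.2 this).trans (Nat.ceil_lt_add_one (by positivity)).le
    push_cast
    linarith

/-! ### The bounds for the random family -/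

/-- The range bound, in the form from which both the first and the third claim follow. -/
lemma exists_random_netTree_ranges (X : Type*) [MetricSpace X] [Finite X] [Nontrivial X]
    (w : X → ℝ≥0) {z ε τ : ℝ} (hε : 0 < ε) (hε' : ε ≤ 1 / 16) (hτ : 0 < τ) (hτ' : τ < 1) :
    ∃ (N : HierarchicalNet X) (P : PMF (NetTree N)), (∀ T ∈ P.support, T.SmallDrift) ∧
      ∀ H : Finset X, 2 ≤ H.card → ENNReal.ofReal (1 - τ) ≤ P.toOuterMeasure
        {T | ((ranges (T.weightedPow w ε z '' (H : Set X))).ncard : ℝ) ≤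
          (2048 / ε) ^ (4 * doublingDim X) * Real.log (H.card / τ) * (H.card : ℝ) ^ 4} := by
  obtain ⟨hδ, t, ht, htδ, hcov⟩ := exists_halfCovering_le (X := X)
  obtain ⟨e, he, he'⟩ := exists_dyadic hε hε'
  have hone : (1 : ℝ) ≤ 2 ^ t := Real.one_le_rpow (by norm_num) (by linarith)
  have hA : 1 ≤ ⌊((2 : ℝ) ^ t) ^ 5⌋₊ := Nat.le_floor (by exact_mod_cast one_le_pow₀ hone)
  have hV : 1 ≤ ⌊((2 : ℝ) ^ t) ^ (e + 4)⌋₊ := Nat.le_floor (by exact_mod_cast one_le_pow₀ hone)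
  obtain ⟨i₀, N, P, hi₀, hdrift, hP⟩ :=
    exists_random_netTree hcov (A := ⌊((2 : ℝ) ^ t) ^ 5⌋₊) hA (Nat.lt_floor_add_one _)
  refine ⟨N, P, hdrift, fun H hH => ?_⟩
  obtain ⟨ℓ, hℓ, hℓ'⟩ := exists_blocks hH hA hτ hτ'
  refine (ENNReal.ofReal_le_ofReal (by linarith)).trans ((hP H ℓ).trans
    (P.toOuterMeasure.mono fun T hT => ?_))
  have hcount := hT.1.ncard_ranges_le (z := z) hi₀ hε hε' he
    (V := ⌊((2 : ℝ) ^ t) ^ (e + 4)⌋₊) (fun h j F hF hFd => by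
      refine Nat.le_floor (hcov.card_le (e + 4) h (ρ := (2 : ℝ) ^ j) (by positivity) F
        (fun a ha b hb hab => N.le_dist (hF a ha) (hF b hb) hab) fun a ha => ?_)
      refine (hFd a ha).trans_eq ?_
      rw [add_assoc, zpow_add₀ (by norm_num), zpow_add₀ (by norm_num), zpow_natCast, pow_add]
      norm_num
      ring) w H (Finset.card_pos.1 (by omega)) hT.2
  have hcount' := hcount.trans (count_le (by omega) hV (by omega))
  have hb := bound_le (n := H.card) hδ ht htδ hε hε' he' hA (Nat.floor_le (by positivity))
    (Nat.floor_le (by positivity)) (half_le_log_div hH hτ hτ') hℓ'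
  refine le_trans ?_ hb
  exact_mod_cast hcount'

lemma exists_probDim_eq {Ω V α : Type*} {P : PMF Ω} {F : Ω → V → α → ℝ} {τ : ℝ} {k : ℕ}
    (h : ∀ H : Finset V, 2 ≤ H.card → ENNReal.ofReal (1 - τ) ≤
      P.toOuterMeasure {ω | (ranges (F ω '' (H : Set V))).ncard ≤ H.card ^ k}) :
    ∃ t : ℕ, probDim P F τ = t ∧ t ≤ k := by
  have hle : probDim P F τ ≤ k := sInf_le ⟨k, rfl, h⟩
  obtain ⟨t, ht⟩ := ENat.ne_top_iff_exists.1 (ne_top_of_le_ne_top (ENat.natCast_ne_top k) hle)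
  exact ⟨t, ht.symm, by rw [← ht] at hle; exact_mod_cast hle⟩

/-- On a space with at most one point every level of the hierarchy is the whole space, and the
tree is a single path. -/
lemma exists_netTree_of_subsingleton (X : Type*) [MetricSpace X] [Subsingleton X] :
    ∃ N : HierarchicalNet X, Nonempty (NetTree N) :=
  ⟨⟨fun _ => Set.univ, fun i => ⟨subset_rfl, fun x _ y _ h => absurd (Subsingleton.elim x y) h,
    fun x hx => ⟨x, hx, by rw [dist_self]; positivity⟩⟩, fun _ _ => rfl⟩,
    ⟨⟨fun _ => id, fun _ _ _ => trivial, fun _ => id, fun _ _ _ => rfl, fun _ _ => rfl⟩⟩⟩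

end SmoothedDoubling

end

theorem mainTheorem3 :
    ∃ C : ℝ, 0 < C ∧
      ∀ (X : Type*) [MetricSpace X] [Finite X] (w : X → ℝ≥0),
        SmoothedDoubling.IsGapWeight 2 w →
      ∀ z ε τ : ℝ, 0 < z → 0 < ε → ε ≤ 1 / (100 * z) → ε ≤ 1 / 16 → 0 < τ → τ < 1 →
      ∃ (N : SmoothedDoubling.HierarchicalNet X) (P : PMF (SmoothedDoubling.NetTree N)),
        (∀ H : Finset X, 2 ≤ H.card →
          ENNReal.ofReal (1 - τ) ≤ P.toOuterMeasure
            {T | ((SmoothedDoubling.ranges (T.weightedPow w ε z '' (H : Set X))).ncard : ℝ) ≤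
              (C / ε) ^ (C * SmoothedDoubling.doublingDim X) *
                Real.log ((H.card : ℝ) / τ) * (H.card : ℝ) ^ 6}) ∧
        (∀ T ∈ P.support, ∀ x y : X,
          (1 - C * (ε * z)) * (T.smoothedDist ε x y) ^ z ≤ (dist x y) ^ z ∧
          (dist x y) ^ z ≤ (1 + C * (ε * z)) * (T.smoothedDist ε x y) ^ z) ∧
        (∃ t : ℕ,
          SmoothedDoubling.probDim P (fun T => T.weightedPow w ε z) τ = t ∧
          (t : ℝ) ≤ C * (SmoothedDoubling.doublingDim X * Real.log (1 / ε) +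
            max 0 (Real.log (Real.log (1 / τ))))) := by
  refine ⟨2048, by norm_num, fun X _ _ w _ z ε τ hz hε hεz hε' hτ hτ' => ?_⟩
  have hlε : 0 ≤ Real.log (1 / ε) := Real.log_nonneg (by rw [le_div_iff₀ hε]; linarith)
  have hdim := SmoothedDoubling.doublingDim_nonneg X
  rcases subsingleton_or_nontrivial X with hX | hX
  · obtain ⟨N, ⟨T₀⟩⟩ := SmoothedDoubling.exists_netTree_of_subsingleton X
    have hH : ∀ H : Finset X, ¬ 2 ≤ H.card := fun H h => by
      have := Finset.card_le_one_of_subsingleton H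
      omega
    refine ⟨N, PMF.pure T₀, fun H h => absurd h (hH H), fun T _ x y => ?_, ?_⟩
    · rw [Subsingleton.elim x y, SmoothedDoubling.NetTree.smoothedDist_self, dist_self,
        Real.zero_rpow hz.ne']
      simp
    · obtain ⟨t, ht, ht'⟩ := SmoothedDoubling.exists_probDim_eq (P := PMF.pure T₀)
        (F := fun T => T.weightedPow w ε z) (τ := τ) (k := 0) fun H h => absurd h (hH H)
      obtain rfl : t = 0 := by omega
      refine ⟨0, ht, ?_⟩
      rw [Nat.cast_zero]
      positivity
  · obtain ⟨N, P, hdrift, hP⟩ :=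
      SmoothedDoubling.exists_random_netTree_ranges X w (z := z) hε hε' hτ hτ'
    have hdim1 := (SmoothedDoubling.exists_halfCovering_le (X := X)).1
    refine ⟨N, P, fun H hH => (hP H hH).trans (P.toOuterMeasure.mono fun T hT => ?_),
      fun T hT x y => (hdrift T hT).rpow_distortion (by norm_num) hz hε hεz hε' x y, ?_⟩
    · have hn : (1 : ℝ) ≤ H.card := by exact_mod_cast (show 1 ≤ H.card by omega)
      have hlog := SmoothedDoubling.half_le_log_div hH hτ hτ'
      have hbase : (1 : ℝ) ≤ 2048 / ε := by
        rw [le_div_iff₀ hε]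
        linarith
      refine le_trans (Set.mem_ofPred_eq ▸ hT) ?_
      gcongr
      all_goals norm_num
    · obtain ⟨k, hk, hk'⟩ := SmoothedDoubling.exists_exponent hdim1 hε hε' hτ hτ'
      obtain ⟨t, ht, htk⟩ := SmoothedDoubling.exists_probDim_eq (P := P)
        (F := fun T => T.weightedPow w ε z) (τ := τ) (k := k) fun H hH =>
          (hP H hH).trans (P.toOuterMeasure.mono fun T hT => by
            have := le_trans hT (hk H.card hH)
            exact_mod_cast this)
      exact ⟨t, ht, le_trans (by exact_mod_cast htk) hk'⟩
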